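/- **Setting.** Let $f_0,g_0$ be positive, continuous, symmetric probability densities on $\mathbb R$ with distribution functions $F_0,G_0$. Let $g_0(s)\sim e^{-\psi(s)}$ for $s\to\infty$, where near infinity $\psi$ is $C^2$ with $\psi'>0$, $\psi(s)\to\infty$, and the scale function $a=1/\psi'$ satisfies $a'(s)\to0$. Let $K(x_1,x_2)=(K_0(x_1),K_0(x_2))$ with $K_0=F_0^{-1}\circ G_0$. Let $\lambda>0$ and let $\rho$ be a measure on $\mathbb R^2\setminus\{0\}$ whose two marginals have intensity $\lambda/|t|^{\lambda+1}$ on $\mathbb R\setminus\{0\}$, and which does not charge the coordinate axes. Let $F^*$ be a probability distribution on $\mathbb R^2$ whose marginals are tail asymptotic to $F_0$ (in both tails), and which lies in the domain of $\rho$: for constants $c_n$ with $n(1-F_0(c_n))\to1$ one has $n\int\varphi(z/c_n)\,dF^*(z)\to\int\varphi\,d\rho$ for every bounded continuous $\varphi$ vanishing on a ball centered in the origin. *The diagonal region.* Define $t_n$ and $t_{n,j}$ by $1-F_0(t_n)=e^{-\sqrt n}$ and $1-F_0(t_{n,j})=n e^{-\sqrt n}/j$, and set $j_n=\lfloor\sqrt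 n\rfloor$. For given $n_0$ let $$D=\bigcup_{n\ge n_0}\{z\in\mathbb R^2: t_n\le |z_1|\vee|z_2|\le t_{n+1},\ |z_1|\wedge|z_2|\ge t_{n,j_n}\}.$$ Let $F$ be a probability distribution obtained from $F^*$ by deleting the mass outside $D$ and changing the measure on a bounded set, that is, for some $R$, $F(A)=F^*(A\cap D)$ for all Borel sets $A\subset\{\|z\|>R\}$. Let $G=F\circ K$ be the meta distribution based on $F$: a vector $\mathbf X$ has distribution $G$ if $K(\mathbf X)$ has distribution $F$. *The weights.* Let $\rho^+$ be the image of $\rho$ under $(x,y)\mapsto(x\vee0,y\vee0)$ (off the origin), let $\sigma^+$ on $[-\infty,\infty)^2\setminus\{(-\infty,-\infty)\}$ be the image of $\rho^+$ under the coordinatewise map $w\mapsto\lambda\log w$ (with $\log 0=-\infty$), and let $\sigma$ be the restriction of $\sigma^+$ to $\mathbb R^2$. Put $$c_-=\rho((-\infty,0)\times(1,\infty)),\quad c_+=\rho((0,\infty)\times(1,\infty)),\quad c=\rho(\mathbb R\times(1,\infty)),\quad p_\pm=c_\pm/c.$$ Finally let $H_t=\{(x,y):y\ge t\}$ and $\alpha_t(u,v)=(tu,\,t+a(t)v)$;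 let $\mathbf X^{H_t}$ be the vector $\mathbf X$ conditioned to lie in $H_t$. **Proposition.** 1. $c_-=\rho^+(\{0\}\times(1,\infty))=\sigma^+(\{-\infty\}\times(0,\infty))$, $c_+=\sigma(\mathbb R\times(0,\infty))$, $c=c_-+c_+$, and $p_-+p_+=1$. 2. $\mathbb P\{\mathbf X\in H_t\}>0$ for all $t$, and $\alpha_t^{-1}(\mathbf X^{H_t})\Rightarrow(U,V)$ for $t\to\infty$, where $U$ and $V$ are independent, $V$ is standard exponential, and $U$ assumes only the two values $\pm1$, with $\mathbb P\{U=-1\}=p_-$ and $\mathbb P\{U=1\}=p_+$. 3. Let $\mathbf X_1,\mathbf X_2,\dots$ be independent with distribution $G$. If $n\,\mathbb P\{\mathbf X\in H_{r_n}\}\to1$, then the sample clouds $\tilde M_n=\{\alpha_{r_n}^{-1}(\mathbf X_1),\dots,\alpha_{r_n}^{-1}(\mathbf X_n)\}$ converge in distribution to $\tilde M$ weakly on $\{v\ge v_0\}$ for every $v_0\in\mathbb R$; that is, for every bounded continuous $\varphi$ the sum of $\varphi$ over the points of $\tilde M_n$ in $\{v\ge v_0\}$ converges in distribution to the corresponding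 sum for $\tilde M$. Here $\tilde M$ is the Poisson point process which lives on the two vertical lines $\{u=-1\}$ and $\{u=1\}$, with intensity $p_-e^{-v}$ on the first and $p_+e^{-v}$ on the second. -/

import Mathlib

open MeasureTheory ProbabilityTheory Filter Set Topology BoundedContinuousFunction

noncomputable section

/-! ### Univariate distributions -/

/-- A positive continuous symmetric probability density on the line. -/
structure IsSymmetricDensity (f : ℝ → ℝ) : Prop where
  continuous : Continuous f
  pos : ∀ x, 0 < f x
  symm : ∀ x, f (-x) = f x
  integrable : Integrable f
  integral_eq_one : ∫ x, f x = 1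

/-- The distribution function with density `f`. -/
def distFun (f : ℝ → ℝ) (s : ℝ) : ℝ := ∫ x in Iic s, f x

/-- The quantile function (inverse) of a distribution function. -/
def quantile (F : ℝ → ℝ) (q : ℝ) : ℝ := sInf {t : ℝ | q ≤ F t}

/-- The scale function `a = 1 / ψ'` of `e^{-ψ}`. -/
def scaleFun (ψ : ℝ → ℝ) (s : ℝ) : ℝ := 1 / deriv ψ s

/-- `e^{-ψ}` is a von Mises function: near infinity `ψ` is `C²` with positive derivative,
`ψ(s) → ∞`, and the derivative of the scale function vanishes in infinity. -/
structure IsVonMises (ψ : ℝ → ℝ) : Prop where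
  regular : ∃ s₀ : ℝ, ContDiffOn ℝ 2 ψ (Ioi s₀) ∧ ∀ s, s₀ < s → 0 < deriv ψ s
  tendsto_atTop : Tendsto ψ atTop atTop
  deriv_scale : Tendsto (deriv (scaleFun ψ)) atTop (𝓝 0)

/-- The law `ν` on the line is tail asymptotic, in both tails, to the distribution function `F`. -/
def TailAsymptotic (ν : Measure ℝ) (F : ℝ → ℝ) : Prop :=
  Tendsto (fun t : ℝ => ν.real (Iic (-t)) / F (-t)) atTop (𝓝 1) ∧
  Tendsto (fun t : ℝ => ν.real (Ioi t) / (1 - F t)) atTop (𝓝 1)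

/-! ### Heavy-tailed laws on the plane -/

/-- `ρ` is an excess measure on the punctured plane whose two marginals both have intensity
`lam / |t| ^ (lam + 1)` off the origin, and which does not charge the coordinate axes. -/
structure IsExcessMeasure (ρ : Measure (ℝ × ℝ)) (lam : ℝ) : Prop where
  marginal_fst : (ρ.map Prod.fst).restrict {0}ᶜ =
    volume.withDensity (fun t : ℝ => ENNReal.ofReal (lam / |t| ^ (lam + 1)))
  marginal_snd : (ρ.map Prod.snd).restrict {0}ᶜ =
    volume.withDensity (fun t : ℝ => ENNReal.ofReal (lam / |t| ^ (lam + 1)))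
  axes_null : ρ {w : ℝ × ℝ | w.1 = 0 ∨ w.2 = 0} = 0

/-- The law `π` lies in the domain of the excess measure `ρ`, with scaling constants `c n`
satisfying `1 - F₀ (c n) ∼ 1 / n`: the measures `n π`, scaled by `c n`, converge to `ρ` weakly on
the complement of centered balls. -/
def InDomain (π ρ : Measure (ℝ × ℝ)) (F₀ : ℝ → ℝ) : Prop :=
  ∃ c : ℕ → ℝ, Tendsto (fun n : ℕ => (n : ℝ) * (1 - F₀ (c n))) atTop (𝓝 1) ∧
    ∀ r : ℝ, 0 < r → ∀ φ : (ℝ × ℝ) →ᵇ ℝ, (∀ w ∈ Metric.ball (0 : ℝ × ℝ) r, φ w = 0) →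
      Tendsto (fun n : ℕ => (n : ℝ) * ∫ z, φ (z.1 / c n, z.2 / c n) ∂π) atTop (𝓝 (∫ w, φ w ∂ρ))

/-- The division points of the block partition in the heavy-tailed space:
`1 - F₀ (t_n) = exp (-√n)`. -/
def divPoint (F₀ : ℝ → ℝ) (n : ℕ) : ℝ := quantile F₀ (1 - Real.exp (-√(n : ℝ)))

/-- The subdivision points: `1 - F₀ (t_{n,j}) = n exp (-√n) / j`. -/
def subdivPoint (F₀ : ℝ → ℝ) (n j : ℕ) : ℝ :=
  quantile F₀ (1 - (n : ℝ) * Real.exp (-√(n : ℝ)) / (j : ℝ))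

/-- The diagonal region `D` in the heavy-tailed space: the union, over the rings between the
successive squares `[-t_n, t_n]²` and `[-t_{n+1}, t_{n+1}]²`, `n ≥ n₀`, of the blocks which in both
coordinates are determined by subdivision points `± t_{n,j}` with `j > j_n = ⌊√n⌋`. -/
def diagonalRegion (F₀ : ℝ → ℝ) (n₀ : ℕ) : Set (ℝ × ℝ) :=
  {z | ∃ n : ℕ, n₀ ≤ n ∧
    divPoint F₀ n ≤ max |z.1| |z.2| ∧ max |z.1| |z.2| ≤ divPoint F₀ (n + 1) ∧
    subdivPoint F₀ n (Nat.sqrt n) ≤ min |z.1| |z.2|}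

/-- `π` is obtained from `πs` by deleting the mass outside `D` and then changing the measure on
a bounded set. -/
def IsRestrictionNearInfinity (π πs : Measure (ℝ × ℝ)) (D : Set (ℝ × ℝ)) : Prop :=
  ∃ R : ℝ, ∀ A : Set (ℝ × ℝ), MeasurableSet A → (∀ z ∈ A, R < ‖z‖) → π A = πs (A ∩ D)

/-- The image `ρ⁺` of `ρ` under `(x, y) ↦ (x ∨ 0, y ∨ 0)`, off the origin. -/
def rhoPlus (ρ : Measure (ℝ × ℝ)) : Measure (ℝ × ℝ) :=
  (ρ.map fun z => (max z.1 0, max z.2 0)).restrict {0}ᶜ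

/-- The inverse of `u ↦ exp (u / lam)`, with value `-∞` in zero. -/
def logCoord (lam : ℝ) (w : ℝ) : EReal := if w = 0 then ⊥ else ((lam * Real.log w : ℝ) : EReal)

/-- The exponent measure `σ⁺`: the coordinatewise logarithmic transform of `ρ⁺`. -/
def sigmaPlus (ρ : Measure (ℝ × ℝ)) (lam : ℝ) : Measure (EReal × EReal) :=
  (rhoPlus ρ).map fun w => (logCoord lam w.1, logCoord lam w.2)

/-- The restriction `σ` of `σ⁺` to the plane. -/
def sigmaReal (ρ : Measure (ℝ × ℝ)) (lam : ℝ) : Measure (ℝ × ℝ) :=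
  (sigmaPlus ρ lam).comap fun u => ((u.1 : EReal), (u.2 : EReal))

/-! ### Meta distributions -/

/-- The component `K₀ = F₀⁻¹ ∘ G₀` of the meta transformation. -/
def metaCoord (f₀ g₀ : ℝ → ℝ) (s : ℝ) : ℝ := quantile (distFun f₀) (distFun g₀ s)

/-- The meta transformation `K`. -/
def metaMap (f₀ g₀ : ℝ → ℝ) (x : ℝ × ℝ) : ℝ × ℝ := (metaCoord f₀ g₀ x.1, metaCoord f₀ g₀ x.2)

/-- `μ` is the meta distribution based on `π`, with meta transformation `K`: if `X` has law `μ`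
then `K(X)` has law `π`. -/
def IsMetaDistribution (μ π : Measure (ℝ × ℝ)) (f₀ g₀ : ℝ → ℝ) : Prop :=
  HasLaw (metaMap f₀ g₀) π μ

/-! ### High risk scenarios and sample clouds -/

/-- The horizontal halfplane `{y ≥ t}`. -/
def upperHalfplane (t : ℝ) : Set (ℝ × ℝ) := {p | t ≤ p.2}

/-- The inverse of the normalization `α_t (u, v) = (t u, t + a(t) v)`. -/
def normInv (a : ℝ → ℝ) (t : ℝ) (p : ℝ × ℝ) : ℝ × ℝ := (p.1 / t, (p.2 - t) / a t)

/-- The measure on the line with mass `p` in `-1` and mass `q` in `1`. -/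
def twoPoint (p q : ENNReal) : Measure ℝ := p • Measure.dirac (-1) + q • Measure.dirac 1

/-- The measure on the line with density `e^{-v}`. -/
def expIntensity : Measure ℝ := volume.withDensity fun v => ENNReal.ofReal (Real.exp (-v))

/-- The `n`-point sample cloud of `X 0, X 1, …` under the normalization `α_t⁻¹`, as a counting
measure. -/
def sampleCloud {Ω : Type*} (a : ℝ → ℝ) (t : ℝ) (X : ℕ → Ω → ℝ × ℝ) (n : ℕ) (ω : Ω) :
    Measure (ℝ × ℝ) :=
  ∑ i ∈ Finset.range n, Measure.dirac (normInv a t (X i ω))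

/-- `M` is a Poisson point process with mean measure `m`: the number of points in a set of finite
mean measure has the Poisson distribution, and the numbers of points in disjoint sets are
independent. -/
structure IsPoissonProcess {Ω E : Type*} [MeasurableSpace Ω] [MeasurableSpace E]
    (M : Ω → Measure E) (m : Measure E) (P : Measure Ω) : Prop where
  measurable : Measurable M
  poisson : ∀ A : Set E, MeasurableSet A → m A ≠ ⊤ →
    HasLaw (fun ω => M ω A) ((poissonMeasure (m A).toNNReal).map fun k : ℕ => (k : ENNReal)) P
  indep : ∀ (k : ℕ) (A : Fin k → Set E), (∀ i, MeasurableSet (A i)) →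
    Pairwise (fun i j => Disjoint (A i) (A j)) → iIndepFun (fun i ω => M ω (A i)) P

/-- The point processes `N n` converge in distribution to `M`, weakly on the set `B`: for every
bounded continuous test function the integrals over `B` converge in distribution. -/
def ConvergesWeaklyOn {Ω Ω' E : Type*} [MeasurableSpace Ω] [MeasurableSpace Ω']
    [MeasurableSpace E] [TopologicalSpace E]
    (N : ℕ → Ω → Measure E) (P : Measure Ω) [IsProbabilityMeasure P]
    (M : Ω' → Measure E) (P' : Measure Ω') [IsProbabilityMeasure P'] (B : Set E) : Prop :=
  ∀ φ : E →ᵇ ℝ, TendstoInDistribution (fun (n : ℕ) ω => ∫ x in B, φ x ∂(N n ω)) atTop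
    (fun ω' => ∫ x in B, φ x ∂(M ω')) (fun _ => P) P'

end

/-! In the heavy-tailed space the deletion costs no mass asymptotically. Convergence of the measures
`n πs` under scaling forces the tail of `distFun f₀` to be dominatedly varying
(`InDomain.dominatedTail`). Near the square of size `t_n` the region `D` omits strips of half-width
`t_{n,j_n}` around the axes; the tail at `t_{n,j_n}` exceeds the tail at `t_n` by the factor `n /
j_n → ∞`, so `t_{n,j_n} = o(t_n)`, and far out `D` swallows every closed cone that meets the axes
only in the origin (`exists_mem_diagonalRegion`). Since `ρ` does not charge the axes, the halfplane
`y ≥ s` keeps mass `∼ 1 - F₀(s)` under `π`, shared between sectors `x > δ s` and `x < -δ s` in the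
proportions `p₊` and `p₋`. Only lower bounds for the sectors are proved directly
(`exists_le_measureReal_sector`); the marginal bound on the halfplane and `p₋ + p₊ = 1` make them
sharp. `HasSectorTails` records the outcome.

The map `K₀` is odd, increasing and tail preserving, so the sign of `x` and the exceedance of a
level by `y` carry over to the meta distribution. The von Mises condition gives `(1 - G₀(t + a(t)
v)) / (1 - G₀(t)) → e^{-v}`, and with the sector proportions the limit `p± e^{-v}`, whence the
independence of `U` and `V`. The tail of `G₀` is moreover rapidly varying, so a constant factor `δ`
in the heavy-tailed coordinate is invisible on the scale of `t`: being off the vertical axis there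
means `|x| ≥ (1 - ε) t` here, whereas `|x| ≥ (1 + ε) t` is too rare to matter. Hence `|x| / t → 1`
(`tendsto_meta_off_diagonal`), and `tendsto_twoPoint_prod` turns these limits into weak convergence.

For the clouds, the characteristic function of a sum over independent points is `(1 + b_n)^n`, where
`n b_n` converges to the integral of `e^{iξφ} - 1` by weak convergence of the rescaled mean
measures. The limit is the characteristic functional of the Poisson process
(`IsPoissonProcess.charFun_integral`). -/

noncomputable section

/-! ### Distribution functions of symmetric densities -/

namespace IsSymmetricDensity

variable {f g : ℝ → ℝ}

lemma distFun_sub_distFun (hf : IsSymmetricDensity f) (s t : ℝ) :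
    distFun f t - distFun f s = ∫ x in s..t, f x :=
  intervalIntegral.integral_Iic_sub_Iic hf.integrable.integrableOn hf.integrable.integrableOn

lemma hasDerivAt_distFun (hf : IsSymmetricDensity f) (t : ℝ) :
    HasDerivAt (distFun f) (f t) t := by
  have h : distFun f = fun t => distFun f 0 + ∫ x in (0 : ℝ)..t, f x := by
    funext t
    rw [← hf.distFun_sub_distFun]
    ring
  rw [h]
  exact (intervalIntegral.integral_hasDerivAt_right (hf.integrable.intervalIntegrable)
    (hf.continuous.stronglyMeasurableAtFilter _ _) hf.continuous.continuousAt).const_add _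

lemma continuous_distFun (hf : IsSymmetricDensity f) : Continuous (distFun f) :=
  continuous_iff_continuousAt.2 fun t => (hf.hasDerivAt_distFun t).continuousAt

lemma strictMono_distFun (hf : IsSymmetricDensity f) : StrictMono (distFun f) :=
  strictMono_of_hasDerivAt_pos hf.hasDerivAt_distFun hf.pos

lemma one_sub_distFun (hf : IsSymmetricDensity f) (s : ℝ) :
    1 - distFun f s = distFun f (-s) := by
  have h2 := intervalIntegral.integral_Iic_add_Ioi (b := s) hf.integrable.integrableOn
    hf.integrable.integrableOn
  have h3 : ∫ x in Ioi s, f x = ∫ x in Iic (-s), f x := by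
    rw [← integral_comp_neg_Ioi]
    simp [hf.symm]
  rw [hf.integral_eq_one] at h2
  unfold distFun
  linarith

lemma tendsto_distFun_atTop (hf : IsSymmetricDensity f) :
    Tendsto (distFun f) atTop (𝓝 1) := by
  have := tendsto_setIntegral_of_monotone (μ := volume) (f := f) (s := fun t : ℝ => Iic t)
    (fun _ => measurableSet_Iic) (fun _ _ h => Iic_subset_Iic.2 h)
    hf.integrable.integrableOn
  rwa [iUnion_Iic, setIntegral_univ, hf.integral_eq_one] at this

lemma tendsto_distFun_atBot (hf : IsSymmetricDensity f) :
    Tendsto (distFun f) atBot (𝓝 0) := by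
  have h : Tendsto (fun s => 1 - distFun f (-s)) atBot (𝓝 (1 - 1)) :=
    (hf.tendsto_distFun_atTop.comp tendsto_neg_atBot_atTop).const_sub 1
  simpa [hf.one_sub_distFun] using h

lemma distFun_pos (hf : IsSymmetricDensity f) (s : ℝ) : 0 < distFun f s :=
  lt_of_le_of_lt (hf.strictMono_distFun.monotone.le_of_tendsto hf.tendsto_distFun_atBot (s - 1))
    (hf.strictMono_distFun (by linarith))

lemma tail_pos (hf : IsSymmetricDensity f) (s : ℝ) : 0 < 1 - distFun f s := by
  rw [hf.one_sub_distFun]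
  exact hf.distFun_pos _

lemma tail_lt_tail_iff (hf : IsSymmetricDensity f) {s t : ℝ} :
    1 - distFun f s < 1 - distFun f t ↔ t < s := by
  rw [sub_lt_sub_iff_left, hf.strictMono_distFun.lt_iff_lt]

lemma tail_le_tail_iff (hf : IsSymmetricDensity f) {s t : ℝ} :
    1 - distFun f s ≤ 1 - distFun f t ↔ t ≤ s := by
  rw [sub_le_sub_iff_left, hf.strictMono_distFun.le_iff_le]

lemma tendsto_tail (hf : IsSymmetricDensity f) :
    Tendsto (fun s => 1 - distFun f s) atTop (𝓝 0) := by
  simpa using hf.tendsto_distFun_atTop.const_sub 1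

/-- A family whose tail probabilities vanish tends to infinity. -/
lemma tendsto_atTop_of_tail (hf : IsSymmetricDensity f) {ι : Type*} {l : Filter ι} {u : ι → ℝ}
    (hu : Tendsto (fun i => 1 - distFun f (u i)) l (𝓝 0)) : Tendsto u l atTop := by
  refine tendsto_atTop.2 fun b => ?_
  filter_upwards [hu.eventually_lt_const (hf.tail_pos b)] with i hi
  exact (hf.tail_lt_tail_iff.1 hi).le

lemma exists_distFun_eq (hf : IsSymmetricDensity f) {q : ℝ} (h0 : 0 < q) (h1 : q < 1) :
    ∃ s, distFun f s = q :=
  mem_range_of_exists_le_of_exists_ge hf.continuous_distFun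
    (hf.tendsto_distFun_atBot.eventually_le_const h0).exists
    (hf.tendsto_distFun_atTop.eventually_const_le h1).exists

lemma quantile_distFun (hf : IsSymmetricDensity f) (s : ℝ) :
    quantile (distFun f) (distFun f s) = s := by
  have : {t : ℝ | distFun f s ≤ distFun f t} = Ici s := by
    ext t
    simp [hf.strictMono_distFun.le_iff_le]
  rw [quantile, this, csInf_Ici]

lemma distFun_quantile (hf : IsSymmetricDensity f) {q : ℝ} (h0 : 0 < q) (h1 : q < 1) :
    distFun f (quantile (distFun f) q) = q := by
  obtain ⟨s, rfl⟩ := hf.exists_distFun_eq h0 h1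
  rw [hf.quantile_distFun]

/-! ### The meta transformation -/

lemma distFun_metaCoord (hf : IsSymmetricDensity f) (hg : IsSymmetricDensity g) (s : ℝ) :
    distFun f (metaCoord f g s) = distFun g s :=
  hf.distFun_quantile (hg.distFun_pos s) (by linarith [hg.tail_pos s])

lemma strictMono_metaCoord (hf : IsSymmetricDensity f) (hg : IsSymmetricDensity g) :
    StrictMono (metaCoord f g) := by
  intro s t h
  rw [← hf.strictMono_distFun.lt_iff_lt, hf.distFun_metaCoord hg, hf.distFun_metaCoord hg]
  exact hg.strictMono_distFun h

lemma metaCoord_neg (hf : IsSymmetricDensity f) (hg : IsSymmetricDensity g) (s : ℝ) :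
    metaCoord f g (-s) = -metaCoord f g s := by
  apply hf.strictMono_distFun.injective
  rw [hf.distFun_metaCoord hg, ← hf.one_sub_distFun, hf.distFun_metaCoord hg, hg.one_sub_distFun]

lemma metaCoord_zero (hf : IsSymmetricDensity f) (hg : IsSymmetricDensity g) :
    metaCoord f g 0 = 0 := by
  have := hf.metaCoord_neg hg 0
  rw [neg_zero] at this
  linarith

lemma metaCoord_pos_iff (hf : IsSymmetricDensity f) (hg : IsSymmetricDensity g) {s : ℝ} :
    0 < metaCoord f g s ↔ 0 < s := by
  simpa [hf.metaCoord_zero hg] using (hf.strictMono_metaCoord hg).lt_iff_lt (a := 0) (b := s)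

lemma abs_metaCoord (hf : IsSymmetricDensity f) (hg : IsSymmetricDensity g) (s : ℝ) :
    |metaCoord f g s| = metaCoord f g |s| := by
  rcases le_total 0 s with h | h
  · rw [abs_of_nonneg h, abs_of_nonneg]
    rw [← hf.metaCoord_zero hg]
    exact (hf.strictMono_metaCoord hg).monotone h
  · rw [abs_of_nonpos h, abs_of_nonpos, hf.metaCoord_neg hg]
    rw [← hf.metaCoord_zero hg]
    exact (hf.strictMono_metaCoord hg).monotone h

lemma tendsto_metaCoord (hf : IsSymmetricDensity f) (hg : IsSymmetricDensity g) :
    Tendsto (metaCoord f g) atTop atTop :=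
  hf.tendsto_atTop_of_tail (by simpa [hf.distFun_metaCoord hg] using hg.tendsto_tail)

end IsSymmetricDensity

/-! ### Von Mises functions -/

namespace IsVonMises

variable {ψ : ℝ → ℝ}

lemma eventually_hasDerivAt (hψ : IsVonMises ψ) :
    ∀ᶠ s in atTop, HasDerivAt ψ (deriv ψ s) s ∧ 0 < scaleFun ψ s ∧
      deriv ψ s = (scaleFun ψ s)⁻¹ ∧
      HasDerivAt (scaleFun ψ) (deriv (scaleFun ψ) s) s := by
  obtain ⟨s₀, hC, hpos⟩ := hψ.regular
  filter_upwards [eventually_gt_atTop s₀] with s hs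
  have hd : DifferentiableAt ℝ ψ s :=
    (hC.differentiableOn (by norm_num)).differentiableAt (Ioi_mem_nhds hs)
  have hC1 : ContDiffOn ℝ 1 (deriv ψ) (Ioi s₀) :=
    hC.deriv_of_isOpen isOpen_Ioi (by norm_num)
  have hd' : DifferentiableAt ℝ (deriv ψ) s :=
    (hC1.differentiableOn (by norm_num)).differentiableAt (Ioi_mem_nhds hs)
  refine ⟨hd.hasDerivAt, one_div_pos.2 (hpos s hs), by simp [scaleFun], ?_⟩
  exact ((differentiableAt_const (1 : ℝ)).div hd' (hpos s hs).ne').hasDerivAt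

lemma exists_lipschitz_scaleFun (hψ : IsVonMises ψ) {ε : ℝ} (hε : 0 < ε) :
    ∃ T, ∀ s, T ≤ s → ∀ t, T ≤ t → |scaleFun ψ t - scaleFun ψ s| ≤ ε * |t - s| := by
  have h1 := hψ.deriv_scale.abs.eventually_le_const (by simpa using hε : |(0 : ℝ)| < ε)
  obtain ⟨T, hT⟩ := eventually_atTop.1 (hψ.eventually_hasDerivAt.and h1)
  refine ⟨T, fun s hs t ht => ?_⟩
  exact Convex.norm_image_sub_le_of_norm_hasDerivWithin_le (s := Ici T)
    (fun x hx => ((hT x hx).1.2.2.2).hasDerivWithinAt) (fun x hx => (hT x hx).2)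
    (convex_Ici T) hs ht

/-- Far out `a` has an arbitrarily small Lipschitz constant, so it grows sublinearly. -/
lemma tendsto_scaleFun_div (hψ : IsVonMises ψ) :
    Tendsto (fun t => scaleFun ψ t / t) atTop (𝓝 0) := by
  rw [Metric.tendsto_atTop']
  intro ε hε
  obtain ⟨T, hT⟩ := hψ.exists_lipschitz_scaleFun (half_pos hε)
  have h1 : ∀ᶠ t in atTop, |scaleFun ψ (max T 0)| < ε / 2 * t :=
    (tendsto_id.const_mul_atTop (half_pos hε)).eventually_gt_atTop _
  obtain ⟨S, hS⟩ := eventually_atTop.1 (h1.and (eventually_gt_atTop (max T 0)))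
  refine ⟨S, fun t ht => ?_⟩
  obtain ⟨h2, h3⟩ := hS t ht.le
  have h0 : 0 < t := lt_of_le_of_lt (le_max_right _ _) h3
  have h4 := hT (max T 0) (le_max_left _ _) t ((le_max_left T 0).trans h3.le)
  have h5 : |t - max T 0| ≤ t := by
    rw [abs_of_nonneg (by linarith)]
    linarith [le_max_right T 0]
  rw [Real.dist_eq, sub_zero, abs_div, abs_of_pos h0, div_lt_iff₀ h0]
  have h6 := abs_sub_abs_le_abs_sub (scaleFun ψ t) (scaleFun ψ (max T 0))
  nlinarith

lemma eventually_scaleFun_mul_le (hψ : IsVonMises ψ) (v : ℝ) {ε : ℝ} (hε : 0 < ε) :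
    ∀ᶠ t in atTop, scaleFun ψ t * |v| ≤ ε * t := by
  have h := (hψ.tendsto_scaleFun_div.mul_const |v|).eventually_le_const
    (by simpa using hε : 0 * |v| < ε)
  filter_upwards [h, eventually_gt_atTop 0] with t h1 h0
  rwa [div_mul_eq_mul_div, div_le_iff₀ h0] at h1

lemma tendsto_add_scaleFun_mul (hψ : IsVonMises ψ) (v : ℝ) :
    Tendsto (fun t => t + scaleFun ψ t * v) atTop atTop := by
  have h : Tendsto (fun t : ℝ => 1 / 2 * t) atTop atTop :=
    tendsto_id.const_mul_atTop (by norm_num)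
  refine tendsto_atTop_mono' _ ?_ h
  filter_upwards [hψ.eventually_scaleFun_mul_le v (show (0 : ℝ) < 1 / 2 by norm_num),
    hψ.eventually_hasDerivAt] with t h1 h2
  nlinarith [neg_abs_le v]

/-- The map `w ↦ ψ(t + a(t) w) - w` has derivative `a(t) / a(t + a(t) w) - 1`. It is uniformly small
between `0` and `v`, because `a` is nearly constant on a range of length `a(t) |v|`; the mean value
inequality concludes. -/
lemma tendsto_sub (hψ : IsVonMises ψ) (v : ℝ) :
    Tendsto (fun t => ψ (t + scaleFun ψ t * v) - ψ t) atTop (𝓝 v) := by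
  rw [Metric.tendsto_nhds]
  intro ε hε
  -- The first bound keeps `a(t + a(t) w)` above `a(t) / 2`; the second makes the final error `2 δ
  -- v²` smaller than `ε`.
  set δ : ℝ := min (1 / (2 * (1 + |v|))) (ε / (4 * (1 + v ^ 2))) with hδ
  have hδ0 : 0 < δ := by positivity
  have hδ1 : δ * |v| ≤ 1 / 2 := by
    have : δ * (2 * (1 + |v|)) ≤ 1 := (le_div_iff₀ (by positivity)).1 (min_le_left _ _)
    nlinarith
  have hδ2 : 2 * δ * v ^ 2 < ε := by
    have : δ * (4 * (1 + v ^ 2)) ≤ ε := (le_div_iff₀ (by positivity)).1 (min_le_right _ _)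
    nlinarith [sq_nonneg v]
  obtain ⟨T, hT⟩ := hψ.exists_lipschitz_scaleFun hδ0
  obtain ⟨S, hS⟩ := eventually_atTop.1 hψ.eventually_hasDerivAt
  -- As `a(t) |v| ≤ t / 2`, all points `t + a(t) w` lie above `t / 2`; this explains the threshold
  -- `2 * max T S`.
  filter_upwards [hψ.eventually_scaleFun_mul_le v (show (0 : ℝ) < 1 / 2 by norm_num),
    eventually_ge_atTop (2 * max T S), eventually_ge_atTop (max T S), eventually_ge_atTop 0]
    with t h1 h2 h3 h0
  have ha := (hS t ((le_max_right _ _).trans h3)).2.1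
  have key : ∀ w ∈ uIcc 0 v, max T S ≤ t + scaleFun ψ t * w := by
    intro w hw
    have hw' : |w| ≤ |v| := by
      simpa using abs_sub_left_of_mem_uIcc hw
    nlinarith [neg_abs_le w]
  have hderiv : ∀ w ∈ uIcc 0 v, HasDerivWithinAt (fun w => ψ (t + scaleFun ψ t * w) - w)
      ((scaleFun ψ (t + scaleFun ψ t * w))⁻¹ * scaleFun ψ t - 1) (uIcc 0 v) w := by
    intro w hw
    have h4 := hS _ ((le_max_right _ _).trans (key w hw))
    have h5 : HasDerivAt (fun w => t + scaleFun ψ t * w) (scaleFun ψ t) w := by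
      simpa using ((hasDerivAt_id w).const_mul (scaleFun ψ t)).const_add t
    rw [← h4.2.2.1]
    exact ((h4.1.comp w h5).sub (hasDerivAt_id w)).hasDerivWithinAt
  have hbound : ∀ w ∈ uIcc 0 v,
      ‖(scaleFun ψ (t + scaleFun ψ t * w))⁻¹ * scaleFun ψ t - 1‖ ≤ 2 * δ * |v| := by
    intro w hw
    have h4 := hS _ ((le_max_right _ _).trans (key w hw))
    have h5 := hT _ ((le_max_left _ _).trans (key w hw)) t ((le_max_left _ _).trans h3)
    have hw' : |w| ≤ |v| := by
      simpa using abs_sub_left_of_mem_uIcc hw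
    have h6 : |t - (t + scaleFun ψ t * w)| ≤ scaleFun ψ t * |v| := by
      rw [sub_add_cancel_left, abs_neg, abs_mul, abs_of_pos ha]
      gcongr
    have h7 : |scaleFun ψ t - scaleFun ψ (t + scaleFun ψ t * w)| ≤ δ * |v| * scaleFun ψ t := by
      nlinarith
    have h8 : scaleFun ψ t ≤ 2 * scaleFun ψ (t + scaleFun ψ t * w) := by
      have := (abs_le.1 h7).2
      nlinarith
    have h9 : (scaleFun ψ (t + scaleFun ψ t * w))⁻¹ * scaleFun ψ t - 1 =
        (scaleFun ψ t - scaleFun ψ (t + scaleFun ψ t * w)) / scaleFun ψ (t + scaleFun ψ t * w) := by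
      field_simp [h4.2.1.ne']
    rw [h9, Real.norm_eq_abs, abs_div, abs_of_pos h4.2.1, div_le_iff₀ h4.2.1]
    refine h7.trans ?_
    have := mul_le_mul_of_nonneg_left h8 (by positivity : 0 ≤ δ * |v|)
    linarith
  have h := Convex.norm_image_sub_le_of_norm_hasDerivWithin_le hderiv hbound
    (convex_uIcc 0 v) left_mem_uIcc right_mem_uIcc
  rw [Real.dist_eq]
  simp only [mul_zero, add_zero, sub_zero, Real.norm_eq_abs] at h
  have h10 : ψ (t + scaleFun ψ t * v) - ψ t - v = ψ (t + scaleFun ψ t * v) - v - ψ t := by ring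
  rw [h10]
  refine h.trans_lt ?_
  rwa [mul_assoc, ← sq, sq_abs]

/-- A tail function with von Mises density is attracted by the exponential law. -/
lemma tendsto_tail_div (hψ : IsVonMises ψ) {g : ℝ → ℝ} (hg : IsSymmetricDensity g)
    (hgψ : Tendsto (fun s => g s / Real.exp (-ψ s)) atTop (𝓝 1)) (v : ℝ) :
    Tendsto (fun t => (1 - distFun g (t + scaleFun ψ t * v)) / (1 - distFun g t)) atTop
      (𝓝 (Real.exp (-v))) := by
  have hr := hψ.tendsto_add_scaleFun_mul v
  -- Both tails vanish at infinity, so it suffices to treat the quotient of derivatives, `g(t + a(t)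
  -- v) (1 + a'(t) v) / g(t)`.
  refine HasDerivAt.lhopital_zero_atTop
    (f' := fun t => -(g (t + scaleFun ψ t * v) * (1 + deriv (scaleFun ψ) t * v)))
    (g' := fun t => -g t) ?_ ?_ ?_ (hg.tendsto_tail.comp hr) hg.tendsto_tail ?_
  · filter_upwards [hψ.eventually_hasDerivAt] with t ht
    have h1 : HasDerivAt (fun t => t + scaleFun ψ t * v) (1 + deriv (scaleFun ψ) t * v) t :=
      (hasDerivAt_id t).add (ht.2.2.2.mul_const v)
    exact ((hg.hasDerivAt_distFun _).comp t h1).const_sub 1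
  · exact .of_forall fun t => (hg.hasDerivAt_distFun t).const_sub 1
  · exact .of_forall fun t => neg_ne_zero.2 (hg.pos t).ne'
  · have h1 := ((hgψ.comp hr).div hgψ one_ne_zero).mul
      (((hψ.tendsto_sub v).neg.rexp).mul ((hψ.deriv_scale.mul_const v).const_add 1))
    simp only [div_one, zero_mul, add_zero, mul_one, one_mul] at h1
    refine h1.congr fun t => ?_
    simp only [Function.comp_apply, neg_sub, Pi.div_apply]
    have h2 := (hg.pos t).ne'
    have h3 : Real.exp (ψ t - ψ (t + scaleFun ψ t * v)) =
        Real.exp (-ψ (t + scaleFun ψ t * v)) / Real.exp (-ψ t) := by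
      rw [← Real.exp_sub]
      ring_nf
    rw [h3]
    field_simp

/-- The tail is rapidly varying: upwards. -/
lemma tendsto_tail_mul_div (hψ : IsVonMises ψ) {g : ℝ → ℝ} (hg : IsSymmetricDensity g)
    (hgψ : Tendsto (fun s => g s / Real.exp (-ψ s)) atTop (𝓝 1)) {ε : ℝ} (hε : 0 < ε) :
    Tendsto (fun t => (1 - distFun g ((1 + ε) * t)) / (1 - distFun g t)) atTop (𝓝 0) := by
  rw [tendsto_order]
  refine ⟨fun b hb => .of_forall fun t => hb.trans (div_pos (hg.tail_pos _) (hg.tail_pos _)),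
    fun b hb => ?_⟩
  -- For fixed `v` with `e^{-v} < b`, the point `(1 + ε) t` eventually lies beyond `t + a(t) v`,
  -- because `a(t) = o(t)`.
  obtain ⟨v, hv⟩ := (Real.tendsto_exp_neg_atTop_nhds_zero.eventually_lt_const hb).exists
  filter_upwards [(hψ.tendsto_tail_div hg hgψ v).eventually_lt_const hv,
    hψ.eventually_scaleFun_mul_le v hε, hψ.eventually_hasDerivAt] with t h1 h2 h3
  refine lt_of_le_of_lt ?_ h1
  have h4 : t + scaleFun ψ t * v ≤ (1 + ε) * t := by
    nlinarith [le_abs_self v]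
  exact div_le_div_of_nonneg_right (hg.tail_le_tail_iff.2 h4) (hg.tail_pos t).le

/-- The tail is rapidly varying: downwards. -/
lemma tendsto_tail_mul_div_atTop (hψ : IsVonMises ψ) {g : ℝ → ℝ} (hg : IsSymmetricDensity g)
    (hgψ : Tendsto (fun s => g s / Real.exp (-ψ s)) atTop (𝓝 1)) {ε : ℝ} (hε : 0 < ε) (v : ℝ) :
    Tendsto (fun t => (1 - distFun g ((1 - ε) * t)) /
      (1 - distFun g (t + scaleFun ψ t * v))) atTop atTop := by
  refine Filter.tendsto_atTop.2 fun b => ?_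
  obtain ⟨w, hw⟩ := (Real.tendsto_exp_atTop.eventually_gt_atTop (b / Real.exp v)).exists
  have h1 := (hψ.tendsto_tail_div hg hgψ (-w)).div (hψ.tendsto_tail_div hg hgψ v)
    (Real.exp_pos _).ne'
  have h2 : b < Real.exp (- -w) / Real.exp (-v) := by
    rw [neg_neg, Real.exp_neg v, div_inv_eq_mul]
    rwa [div_lt_iff₀ (Real.exp_pos _)] at hw
  filter_upwards [h1.eventually_const_lt h2,
    hψ.eventually_scaleFun_mul_le w hε, hψ.eventually_hasDerivAt] with t h3 h4 h5
  refine h3.le.trans ?_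
  simp only [Pi.div_apply]
  rw [div_div_div_cancel_right₀ (hg.tail_pos t).ne']
  have h6 : (1 - ε) * t ≤ t + scaleFun ψ t * -w := by
    nlinarith [le_abs_self w]
  exact div_le_div_of_nonneg_right (hg.tail_le_tail_iff.2 h6) (hg.tail_pos _).le

end IsVonMises

/-! ### Excess measures and their exponent measures -/

namespace IsExcessMeasure

variable {ρ : Measure (ℝ × ℝ)} {lam : ℝ}

/-- The density `λ t^{-λ-1}` integrates to one over `(1, ∞)`. Thus `c = 1`, and the weights `p±`
coincide with `c±`. -/
lemma measure_snd_gt_one (hρ : IsExcessMeasure ρ lam) (hlam : 0 < lam) :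
    ρ (univ ×ˢ Ioi 1) = 1 := by
  have h1 : ρ (univ ×ˢ Ioi 1) = ((ρ.map Prod.snd).restrict {0}ᶜ) (Ioi 1) := by
    rw [Measure.restrict_apply measurableSet_Ioi, inter_eq_left.2, Measure.map_apply
      measurable_snd measurableSet_Ioi]
    · rw [univ_prod]
    · intro x hx h0
      rw [mem_singleton_iff] at h0
      rw [h0, mem_Ioi] at hx
      linarith
  rw [h1, hρ.marginal_snd, withDensity_apply _ measurableSet_Ioi]
  have h2 : ∫⁻ t in Ioi (1 : ℝ), ENNReal.ofReal (lam / |t| ^ (lam + 1)) =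
      ∫⁻ t in Ioi (1 : ℝ), ENNReal.ofReal (lam * t ^ (-(lam + 1))) := by
    refine setLIntegral_congr_fun measurableSet_Ioi fun t ht => ?_
    have h0 : (0 : ℝ) < t := one_pos.trans ht
    rw [abs_of_pos h0, Real.rpow_neg h0.le, div_eq_mul_inv]
  have h3 : -(lam + 1) < -1 := by linarith
  rw [h2, ← ofReal_integral_eq_lintegral_ofReal
    ((integrableOn_Ioi_rpow_of_lt h3 one_pos).const_mul lam), integral_const_mul,
    integral_Ioi_rpow_of_lt h3 one_pos]
  · have : lam * (-1 ^ (-(lam + 1) + 1) / (-(lam + 1) + 1)) = 1 := by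
      rw [Real.one_rpow, neg_add_rev, neg_add_cancel_comm, div_neg, neg_div, neg_neg]
      exact mul_one_div_cancel hlam.ne'
    rw [this, ENNReal.ofReal_one]
  · refine (ae_restrict_iff' measurableSet_Ioi).2 (.of_forall fun t ht => ?_)
    have h0 : (0 : ℝ) < t := one_pos.trans ht
    positivity

lemma measure_fst_eq_zero (hρ : IsExcessMeasure ρ lam) : ρ {w | w.1 = 0} = 0 :=
  measure_mono_null (fun _ h => Or.inl h) hρ.axes_null

lemma measure_add (hρ : IsExcessMeasure ρ lam) :
    ρ (univ ×ˢ Ioi 1) = ρ (Iio 0 ×ˢ Ioi 1) + ρ (Ioi 0 ×ˢ Ioi 1) := by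
  rw [← measure_union]
  · refine measure_congr ?_
    filter_upwards [measure_eq_zero_iff_ae_notMem.1 hρ.measure_fst_eq_zero] with w hw
    have hw' : w.1 ≠ 0 := hw
    refine propext ?_
    change w ∈ univ ×ˢ Ioi 1 ↔ w ∈ Iio 0 ×ˢ Ioi 1 ∪ Ioi 0 ×ˢ Ioi 1
    simp only [mem_prod, mem_univ, true_and, mem_union, mem_Iio, mem_Ioi, ← or_and_right]
    simp [hw']
  · rw [disjoint_left]
    rintro w ⟨h1, -⟩ ⟨h2, -⟩
    exact lt_asymm (mem_Iio.1 h1) (mem_Ioi.1 h2)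
  · exact measurableSet_Ioi.prod measurableSet_Ioi

lemma rhoPlus_apply (ρ : Measure (ℝ × ℝ)) {A : Set (ℝ × ℝ)} (hA : MeasurableSet A) :
    rhoPlus ρ A = ρ {z | (max z.1 0, max z.2 0) ∈ A ∧ (max z.1 0, max z.2 0) ≠ (0 : ℝ × ℝ)} := by
  have hm : Measurable fun z : ℝ × ℝ => (max z.1 0, max z.2 0) := by fun_prop
  rw [rhoPlus, Measure.restrict_apply hA, Measure.map_apply hm
    (hA.inter (measurableSet_singleton _).compl)]
  rfl

lemma measurable_logCoord (lam : ℝ) : Measurable (logCoord lam) := by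
  unfold logCoord
  refine Measurable.ite (measurableSet_singleton 0) measurable_const ?_
  exact measurable_coe_real_ereal.comp (Real.measurable_log.const_mul lam)

lemma sigmaPlus_apply (ρ : Measure (ℝ × ℝ)) (lam : ℝ) {A : Set (EReal × EReal)}
    (hA : MeasurableSet A) :
    sigmaPlus ρ lam A =
      ρ {z | (logCoord lam (max z.1 0), logCoord lam (max z.2 0)) ∈ A ∧
        (max z.1 0, max z.2 0) ≠ (0 : ℝ × ℝ)} := by
  have hm : Measurable fun w : ℝ × ℝ => (logCoord lam w.1, logCoord lam w.2) :=
    ((measurable_logCoord lam).comp measurable_fst).prodMk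
      ((measurable_logCoord lam).comp measurable_snd)
  rw [sigmaPlus, Measure.map_apply hm hA, rhoPlus_apply ρ (hm hA)]
  rfl

lemma logCoord_pos_iff (hlam : 0 < lam) (x : ℝ) :
    0 < logCoord lam (max x 0) ↔ 1 < x := by
  unfold logCoord
  split_ifs with h
  · have : x ≤ 0 := by simpa using h
    simp only [not_lt_bot, false_iff, not_lt]
    linarith
  · have hx : 0 < x := by
      by_contra h'
      exact h (max_eq_right (not_lt.1 h'))
    rw [max_eq_left hx.le, EReal.coe_pos, mul_pos_iff_of_pos_left hlam, Real.log_pos_iff hx.le]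

lemma logCoord_lt_top (lam x : ℝ) : logCoord lam x < ⊤ := by
  unfold logCoord
  split_ifs
  · exact bot_lt_top
  · exact EReal.coe_lt_top _

lemma logCoord_eq_bot_iff (lam x : ℝ) : logCoord lam (max x 0) = ⊥ ↔ x ≤ 0 := by
  unfold logCoord
  split_ifs with h
  · simpa using h
  · simpa only [EReal.coe_ne_bot, false_iff, not_le, max_eq_right_iff] using h

lemma ae_fst_ne_zero (hρ : IsExcessMeasure ρ lam) : ∀ᵐ w ∂ρ, w.1 ≠ 0 :=
  measure_eq_zero_iff_ae_notMem.1 hρ.measure_fst_eq_zero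

/-- Truncation at zero does not separate `x = 0` from `x < 0`; since the vertical axis is null,
neither do the masses. -/
lemma measure_Iio_prod (hρ : IsExcessMeasure ρ lam) :
    ρ (Iio 0 ×ˢ Ioi 1) = ρ {z | z.1 ≤ 0 ∧ 1 < z.2} := by
  refine measure_congr ?_
  filter_upwards [hρ.ae_fst_ne_zero] with w hw
  exact propext ⟨fun h => ⟨le_of_lt h.1, h.2⟩, fun h => ⟨lt_of_le_of_ne h.1 hw, h.2⟩⟩

lemma measure_Iio_eq_rhoPlus (hρ : IsExcessMeasure ρ lam) :
    ρ (Iio 0 ×ˢ Ioi 1) = rhoPlus ρ ({0} ×ˢ Ioi 1) := by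
  rw [hρ.measure_Iio_prod, rhoPlus_apply ρ ((measurableSet_singleton 0).prod measurableSet_Ioi)]
  congr 1
  ext z
  simp only [mem_ofPred_eq, mem_prod, mem_singleton_iff, max_eq_right_iff, mem_Ioi, lt_max_iff,
    ne_eq, Prod.mk_eq_zero]
  constructor
  · rintro ⟨h1, h2⟩
    refine ⟨⟨h1, Or.inl h2⟩, fun h => ?_⟩
    linarith [h.2]
  · rintro ⟨⟨h1, h2⟩, -⟩
    exact ⟨h1, h2.resolve_right (by norm_num)⟩

/-- The value `⊥` of the logarithmic coordinate comes exactly from `x ≤ 0`. Excluding `⊤` in the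
second factor is harmless, as `logCoord` never takes this value. -/
lemma measure_Iio_eq_sigmaPlus (hρ : IsExcessMeasure ρ lam) (hlam : 0 < lam) :
    ρ (Iio 0 ×ˢ Ioi 1) = sigmaPlus ρ lam ({⊥} ×ˢ Ioo 0 ⊤) := by
  rw [hρ.measure_Iio_prod,
    sigmaPlus_apply ρ lam ((measurableSet_singleton ⊥).prod measurableSet_Ioo)]
  congr 1
  ext z
  simp only [mem_ofPred_eq, mem_prod, mem_singleton_iff, logCoord_eq_bot_iff, mem_Ioo,
    logCoord_pos_iff hlam, logCoord_lt_top, and_true, ne_eq, Prod.mk_eq_zero]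
  refine ⟨fun h => ⟨h, fun h' => ?_⟩, fun h => h.1⟩
  linarith [max_eq_right_iff.1 h'.2, h.2]

lemma measure_Ioi_eq_sigmaReal (ρ : Measure (ℝ × ℝ)) (hlam : 0 < lam) :
    ρ (Ioi 0 ×ˢ Ioi 1) = sigmaReal ρ lam (univ ×ˢ Ioi 0) := by
  have he : MeasurableEmbedding fun u : ℝ × ℝ => ((u.1 : EReal), (u.2 : EReal)) :=
    EReal.measurableEmbedding_coe.prodMap EReal.measurableEmbedding_coe
  rw [sigmaReal, he.comap_apply, sigmaPlus_apply ρ lam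
    (he.measurableSet_image.2 (MeasurableSet.univ.prod measurableSet_Ioi))]
  congr 1
  ext z
  simp only [mem_prod, mem_Ioi, mem_ofPred_eq, mem_image, mem_univ, true_and, Prod.mk.injEq,
    Prod.exists, ne_eq, Prod.mk_eq_zero]
  constructor
  · rintro ⟨h1, h2⟩
    have h3 : 0 < z.2 := by linarith
    refine ⟨⟨lam * Real.log z.1, lam * Real.log z.2, mul_pos hlam (Real.log_pos h2), ?_, ?_⟩,
      fun h => ?_⟩
    · simp [logCoord, max_eq_left h1.le, h1.ne']
    · simp [logCoord, max_eq_left h3.le, h3.ne']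
    · linarith [max_eq_right_iff.1 h.2]
  · rintro ⟨⟨x, y, hy, h1, h2⟩, -⟩
    constructor
    · by_contra h
      rw [(logCoord_eq_bot_iff lam z.1).2 (not_lt.1 h)] at h1
      exact EReal.coe_ne_bot x h1
    · rw [← logCoord_pos_iff hlam, ← h2]
      exact EReal.coe_pos.2 hy

end IsExcessMeasure

/-! ### Tails of a law in the domain of an excess measure -/

namespace TailAsymptotic

variable {ν : Measure ℝ} {f : ℝ → ℝ}

/-- Tail asymptotics concern the open rays; the closed ray at `s` is contained in the open rays at
`t < s`, and continuity of `distFun f` lets `t` increase to `s`. -/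
lemma eventually_Ici_le [IsFiniteMeasure ν] (h : TailAsymptotic ν (distFun f))
    (hf : IsSymmetricDensity f) {η : ℝ} (hη : 0 < η) :
    ∀ᶠ s in atTop, ν.real (Ici s) ≤ (1 + η) * (1 - distFun f s) := by
  obtain ⟨S, hS⟩ := eventually_atTop.1
    (h.2.eventually_le_const (show (1 : ℝ) < 1 + η by linarith))
  filter_upwards [eventually_gt_atTop S] with s hs
  have h1 : Tendsto (fun t => (1 + η) * (1 - distFun f t)) (𝓝[<] s)
      (𝓝 ((1 + η) * (1 - distFun f s))) :=
    (((hf.continuous_distFun.tendsto s).const_sub 1).const_mul (1 + η)).mono_left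
      nhdsWithin_le_nhds
  refine ge_of_tendsto h1 ?_
  filter_upwards [Ioo_mem_nhdsLT hs] with t ht
  have h2 := hS t ht.1.le
  rw [div_le_iff₀ (hf.tail_pos t)] at h2
  exact (measureReal_mono (Ici_subset_Ioi.2 ht.2)).trans h2

lemma eventually_Iic_le (h : TailAsymptotic ν (distFun f))
    (hf : IsSymmetricDensity f) {η : ℝ} (hη : 0 < η) :
    ∀ᶠ s in atTop, ν.real (Iic (-s)) ≤ (1 + η) * (1 - distFun f s) := by
  filter_upwards [h.1.eventually_le_const (show (1 : ℝ) < 1 + η by linarith)] with s hs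
  rwa [← hf.one_sub_distFun, div_le_iff₀ (hf.tail_pos s)] at hs

lemma eventually_le_Ioi (h : TailAsymptotic ν (distFun f))
    (hf : IsSymmetricDensity f) :
    ∀ᶠ s in atTop, 1 - distFun f s ≤ 2 * ν.real (Ioi s) := by
  filter_upwards [h.2.eventually_const_le (show (1 / 2 : ℝ) < 1 by norm_num)] with s hs
  rw [le_div_iff₀ (hf.tail_pos s)] at hs
  linarith

end TailAsymptotic

/-- The tail of a distribution function is dominatedly varying. -/
def DominatedTail (F : ℝ → ℝ) : Prop :=
  ∀ δ : ℝ, 0 < δ → ∃ C : ℝ, 0 < C ∧ ∀ᶠ s in atTop, 1 - F (δ * s) ≤ C * (1 - F s)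

/-- Scaling constants tend to infinity. -/
lemma IsSymmetricDensity.tendsto_scaling {f : ℝ → ℝ} (hf : IsSymmetricDensity f) {c : ℕ → ℝ}
    (hc : Tendsto (fun n : ℕ => (n : ℝ) * (1 - distFun f (c n))) atTop (𝓝 1)) :
    Tendsto c atTop atTop := by
  refine hf.tendsto_atTop_of_tail ?_
  have h := hc.mul ((tendsto_inv_atTop_zero (𝕜 := ℝ)).comp tendsto_natCast_atTop_atTop)
  rw [mul_zero] at h
  refine h.congr' ?_
  filter_upwards [eventually_gt_atTop 0] with n hn
  have : (n : ℝ) ≠ 0 := by positivity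
  simp only [Function.comp_apply]
  field_simp

/-- A test function above the indicator of `w.2 > δ` bounds `n (1 - F(δ c_n))` uniformly for large
`n`. An arbitrary level `s` is then compared with some `c_n < s` for which `1 / n` is of the order
of the tail at `s`. -/
lemma InDomain.dominatedTail {πs ρ : Measure (ℝ × ℝ)} [IsProbabilityMeasure πs] {f : ℝ → ℝ}
    (hπs : InDomain πs ρ (distFun f)) (hf : IsSymmetricDensity f)
    (htail : TailAsymptotic (πs.map Prod.snd) (distFun f)) : DominatedTail (distFun f) := by
  intro δ hδ
  obtain ⟨c, hc, hφ⟩ := hπs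
  have hc_top := hf.tendsto_scaling hc
  -- A ramp in the second coordinate, rising from `0` at `δ / 2` to `1` at `δ`.
  let φ : (ℝ × ℝ) →ᵇ ℝ := BoundedContinuousFunction.ofNormedAddCommGroup
    (fun w => max 0 (min 1 (2 * w.2 / δ - 1))) (by fun_prop) 1 (fun w => by
      rw [Real.norm_eq_abs, abs_of_nonneg (le_max_left _ _)]
      exact max_le zero_le_one (min_le_left _ _))
  have hφ_apply : ∀ w, φ w = max 0 (min 1 (2 * w.2 / δ - 1)) := fun _ => rfl
  have h1 := hφ (δ / 2) (half_pos hδ) φ (fun w hw => by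
    rw [hφ_apply]
    refine max_eq_left ((min_le_right _ _).trans ?_)
    have h2 : |w.2| < δ / 2 := by
      rw [mem_ball_zero_iff] at hw
      exact (norm_snd_le w).trans_lt hw
    rw [sub_nonpos, div_le_one hδ]
    linarith [le_abs_self w.2])
  set Λ := ∫ w, φ w ∂ρ with hΛ
  have hΛ0 : 0 ≤ Λ := integral_nonneg fun w => le_max_left _ _
  have h3 : ∀ᶠ n : ℕ in atTop, n * (1 - distFun f (δ * c n)) ≤ 2 * (Λ + 1) := by
    filter_upwards [h1.eventually_le_const (lt_add_one Λ),
      (hc_top.const_mul_atTop hδ).eventually (htail.eventually_le_Ioi hf),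
      hc_top.eventually_gt_atTop 0] with n h4 h5 h6
    have h7 : (πs.map Prod.snd).real (Ioi (δ * c n)) ≤ ∫ z, φ (z.1 / c n, z.2 / c n) ∂πs := by
      rw [map_measureReal_apply measurable_snd measurableSet_Ioi,
        ← integral_indicator_one (measurable_snd measurableSet_Ioi)]
      have hcont : Continuous fun z : ℝ × ℝ => φ (z.1 / c n, z.2 / c n) := by fun_prop
      refine integral_mono ((integrable_const (1 : ℝ)).indicator
        (measurable_snd measurableSet_Ioi)) ?_ fun z => ?_
      · exact Integrable.of_bound hcont.aestronglyMeasurable ‖φ‖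
          (.of_forall fun z => φ.norm_coe_le_norm _)
      · refine indicator_le' (f := (1 : ℝ × ℝ → ℝ))
          (g := fun z : ℝ × ℝ => φ (z.1 / c n, z.2 / c n)) (fun z hz => ?_) (fun z _ => ?_) z
        · rw [hφ_apply, Pi.one_apply]
          have hz' : δ * c n < z.2 := hz
          refine (le_min le_rfl ?_ : (1 : ℝ) ≤ _).trans (le_max_right _ _)
          have : 1 ≤ z.2 / c n / δ := by
            rw [div_div, one_le_div (by positivity), mul_comm]
            exact hz'.le
          have h8 : 2 * (z.2 / c n) / δ = 2 * (z.2 / c n / δ) := by ring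
          simp only
          linarith
        · exact le_max_left _ _
    have h8 := mul_le_mul_of_nonneg_left (h5.trans (mul_le_mul_of_nonneg_left h7 zero_le_two))
      (Nat.cast_nonneg (α := ℝ) n)
    linarith
  -- With this `n`, `n (1 - F(s)) ≤ 1/2 < n (1 - F(c_n))` for large `s`, so `c_n < s`. Once the tail
  -- is at most `1/4`, rounding down still leaves `n (1 - F(s)) ≥ 1/4`; hence the factor `4` in the
  -- constant.
  have h4 : Tendsto (fun s => ⌊(1 / 2) * (1 - distFun f s)⁻¹⌋₊) atTop atTop :=
    tendsto_nat_floor_atTop.comp (Tendsto.const_mul_atTop (by norm_num)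
      ((tendsto_inv_nhdsGT_zero).comp (tendsto_nhdsWithin_iff.2
        ⟨hf.tendsto_tail, .of_forall hf.tail_pos⟩)))
  refine ⟨4 * (2 * (Λ + 1)), by positivity, ?_⟩
  filter_upwards [h4.eventually h3, h4.eventually (hc.eventually_const_lt
    (show (1 / 2 : ℝ) < 1 by norm_num)),
    hf.tendsto_tail.eventually_le_const (show (0 : ℝ) < 1 / 4 by norm_num)] with s h5 h6 h7
  set n := ⌊(1 / 2) * (1 - distFun f s)⁻¹⌋₊
  have hT := hf.tail_pos s
  have h8 : (n : ℝ) * (1 - distFun f s) ≤ 1 / 2 := by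
    have := Nat.floor_le (show 0 ≤ (1 / 2) * (1 - distFun f s)⁻¹ by positivity)
    calc (n : ℝ) * (1 - distFun f s) ≤ (1 / 2) * (1 - distFun f s)⁻¹ * (1 - distFun f s) := by
          gcongr
      _ = 1 / 2 := by field_simp
  have h9 : 1 / 4 ≤ (n : ℝ) * (1 - distFun f s) := by
    have := Nat.lt_floor_add_one ((1 / 2) * (1 - distFun f s)⁻¹)
    have h10 : (1 / 2) * (1 - distFun f s)⁻¹ * (1 - distFun f s) ≤
        (n + 1) * (1 - distFun f s) := by
      gcongr
    rw [mul_assoc, inv_mul_cancel₀ hT.ne'] at h10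
    linarith
  have hn : (0 : ℝ) < n := by
    by_contra h
    nlinarith
  have h10 : c n < s := by
    rw [← hf.tail_lt_tail_iff]
    exact lt_of_mul_lt_mul_left (h8.trans_lt h6) hn.le
  have h11 : 1 - distFun f (δ * s) ≤ 1 - distFun f (δ * c n) :=
    hf.tail_le_tail_iff.2 (by gcongr)
  have h12 : 0 ≤ 1 - distFun f (δ * s) := (hf.tail_pos _).le
  have h13 : (n : ℝ) * (1 - distFun f (δ * s)) ≤ 2 * (Λ + 1) :=
    (mul_le_mul_of_nonneg_left h11 hn.le).trans h5
  have h14 : 1 - distFun f (δ * s) ≤ 4 * ((n : ℝ) * (1 - distFun f s)) *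
      (1 - distFun f (δ * s)) := by nlinarith
  calc 1 - distFun f (δ * s) ≤ 4 * (1 - distFun f s) * (n * (1 - distFun f (δ * s))) := by
        linarith
    _ ≤ 4 * (1 - distFun f s) * (2 * (Λ + 1)) := by gcongr
    _ = 4 * (2 * (Λ + 1)) * (1 - distFun f s) := by ring

/-! ### The diagonal region -/

section DiagonalRegion

variable {f : ℝ → ℝ}

lemma quantile_le_of_le {F : ℝ → ℝ} {q x : ℝ} (hq : q ≤ F x) (hx : 0 ≤ x) :
    quantile F q ≤ x := by
  by_cases h : BddBelow {t : ℝ | q ≤ F t}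
  · exact csInf_le h hq
  -- The infimum of a set unbounded below is `0` by convention, which `0 ≤ x` accommodates.
  · rwa [quantile, Real.sInf_of_not_bddBelow h]

lemma tail_divPoint (hf : IsSymmetricDensity f) {n : ℕ} (hn : 0 < n) :
    1 - distFun f (divPoint (distFun f) n) = Real.exp (-√(n : ℝ)) := by
  have h : Real.exp (-√(n : ℝ)) < 1 := by
    rw [Real.exp_lt_one_iff, neg_lt_zero]
    positivity
  rw [divPoint, hf.distFun_quantile (by linarith) (by linarith [Real.exp_pos (-√(n : ℝ))])]
  ring

lemma tendsto_sqrt_natCast : Tendsto (fun n : ℕ => √(n : ℝ)) atTop atTop :=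
  Real.tendsto_sqrt_atTop.comp tendsto_natCast_atTop_atTop

lemma tendsto_divPoint (hf : IsSymmetricDensity f) :
    Tendsto (divPoint (distFun f)) atTop atTop := by
  refine hf.tendsto_atTop_of_tail ?_
  refine (Real.tendsto_exp_neg_atTop_nhds_zero.comp tendsto_sqrt_natCast).congr' ?_
  filter_upwards [eventually_gt_atTop 0] with n hn
  exact (tail_divPoint hf hn).symm

/-- Dominated variation gives `1 - F(κ t_n) ≤ C e^{-√n}`, whereas the level defining `t_{n,j_n}` is
at least `√n e^{-√n}`. The latter wins as soon as `√n ≥ C`. -/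
lemma eventually_subdivPoint_le (hf : IsSymmetricDensity f) (hdom : DominatedTail (distFun f))
    {κ : ℝ} (hκ : 0 < κ) :
    ∀ᶠ n : ℕ in atTop,
      subdivPoint (distFun f) n (Nat.sqrt n) ≤ κ * divPoint (distFun f) n := by
  obtain ⟨C, hC, hC'⟩ := hdom κ hκ
  filter_upwards [(tendsto_divPoint hf).eventually hC', eventually_gt_atTop 0,
    tendsto_sqrt_natCast.eventually_ge_atTop C,
    (tendsto_divPoint hf).eventually_ge_atTop 0] with n h1 hn h2 h3
  refine quantile_le_of_le ?_ (by positivity)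
  rw [tail_divPoint hf hn] at h1
  have h4 : (0 : ℝ) < Nat.sqrt n := by exact_mod_cast Nat.sqrt_pos.2 hn
  have h5 : C ≤ n / Nat.sqrt n := by
    rw [le_div_iff₀ h4]
    calc C * Nat.sqrt n ≤ √(n : ℝ) * √(n : ℝ) := by
          gcongr
          exact Real.nat_sqrt_le_real_sqrt
      _ = n := Real.mul_self_sqrt (Nat.cast_nonneg n)
  have h6 : C * Real.exp (-√(n : ℝ)) ≤ n * Real.exp (-√(n : ℝ)) / Nat.sqrt n := by
    rw [mul_div_right_comm]
    gcongr
  linarith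

/-- Far out, the diagonal region contains every closed cone which meets the coordinate axes in the
origin only. -/
lemma exists_mem_diagonalRegion (hf : IsSymmetricDensity f) (hdom : DominatedTail (distFun f))
    (n₀ : ℕ) {κ : ℝ} (hκ : 0 < κ) :
    ∃ R : ℝ, ∀ z : ℝ × ℝ, R ≤ max |z.1| |z.2| → κ * max |z.1| |z.2| ≤ min |z.1| |z.2| →
      z ∈ diagonalRegion (distFun f) n₀ := by
  obtain ⟨N, hN⟩ := eventually_atTop.1
    ((eventually_subdivPoint_le hf hdom hκ).and (eventually_ge_atTop n₀))
  refine ⟨divPoint (distFun f) N, fun z hz hz' => ?_⟩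
  have hex : ∃ k, max |z.1| |z.2| ≤ divPoint (distFun f) (N + k + 1) := by
    have h1 : Tendsto (fun k => divPoint (distFun f) (N + k + 1)) atTop atTop :=
      (tendsto_divPoint hf).comp (tendsto_atTop_mono (f := id) (fun k => by simp only [id]; omega) tendsto_id)
    exact (h1.eventually_ge_atTop _).exists
  classical
  -- The first ring from `N` on whose outer square contains `z`. Minimality puts `z` outside the
  -- inner square, and for `k = 0` this is the hypothesis on `R`; monotonicity of the division
  -- points is not needed.
  set k := Nat.find hex with hk
  have hle : divPoint (distFun f) (N + k) ≤ max |z.1| |z.2| := by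
    rcases Nat.eq_zero_or_pos k with h0 | h0
    · rwa [h0, add_zero]
    · have := Nat.find_min hex (m := k - 1) (by omega)
      rw [not_le, show N + (k - 1) + 1 = N + k by omega] at this
      exact this.le
  refine ⟨N + k, (hN (N + k) (by omega)).2, hle, Nat.find_spec hex, ?_⟩
  refine (hN (N + k) (by omega)).1.trans (le_trans ?_ hz')
  gcongr

end DiagonalRegion

/-! ### Sectors of the upper halfplane -/

section Sector

variable {ρ πs π : Measure (ℝ × ℝ)} {f : ℝ → ℝ} {n₀ : ℕ}

lemma measurableSet_sector (e a s : ℝ) : MeasurableSet {z : ℝ × ℝ | a < e * z.1 ∧ s ≤ z.2} :=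
  (measurableSet_lt measurable_const (measurable_fst.const_mul e)).inter
    (measurableSet_le measurable_const measurable_snd)

/-- A sector of the excess measure is exhausted by bounded open sets at a positive distance of the
axes, whose measure may be computed from below by continuous functions. -/
lemma exists_integral_sector_gt (hρ : ρ (univ ×ˢ Ioi 1) = 1) (e : ℝ) {η : ℝ} (hη : 0 < η) :
    ∃ (δ M : ℝ) (φ : (ℝ × ℝ) →ᵇ ℝ), 0 < δ ∧ 0 < M ∧ (∀ w, φ w ≤ 1) ∧
      (∀ w, φ w ≠ 0 → δ < e * w.1 ∧ 1 < w.2 ∧ ‖w‖ < M) ∧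
      ρ.real {w | 0 < e * w.1 ∧ 1 < w.2} - η < ∫ w, φ w ∂ρ := by
  set H : Set (ℝ × ℝ) := univ ×ˢ Ioi 1 with hH
  have hHm : MeasurableSet H := MeasurableSet.univ.prod measurableSet_Ioi
  -- The measure `ρ` need not be finite; its restriction to the halfplane is, which allows
  -- continuity from below and inner regularity.
  set ν := ρ.restrict H with hν
  have : IsFiniteMeasure ν := ⟨by simp [hν, hρ]⟩
  set U : ℕ → Set (ℝ × ℝ) := fun k =>
    {w | 1 / ((k : ℝ) + 1) < e * w.1 ∧ 1 < w.2 ∧ ‖w‖ < (k : ℝ) + 1} with hU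
  have hUo : ∀ k, IsOpen (U k) := fun k =>
    (isOpen_lt continuous_const (continuous_fst.const_mul e)).inter
      ((isOpen_lt continuous_const continuous_snd).inter (isOpen_lt continuous_norm
        continuous_const))
  have hUmono : Monotone U := by
    intro k l hkl w hw
    have hkl' : (k : ℝ) ≤ l := by exact_mod_cast hkl
    refine ⟨lt_of_le_of_lt ?_ hw.1, hw.2.1, hw.2.2.trans_le (by linarith)⟩
    gcongr
  have hUnion : ⋃ k, U k = {w | 0 < e * w.1 ∧ 1 < w.2} := by
    ext w
    rw [mem_iUnion]
    constructor
    · rintro ⟨k, hk⟩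
      exact ⟨lt_trans (by positivity) hk.1, hk.2.1⟩
    · rintro ⟨h1, h2⟩
      obtain ⟨k, hk⟩ := exists_nat_one_div_lt h1
      obtain ⟨l, hl⟩ := exists_nat_gt ‖w‖
      have h3 : w ∈ U (max k l) := by
        have hk' : (k : ℝ) ≤ (max k l : ℕ) := by exact_mod_cast le_max_left k l
        have hl' : (l : ℝ) ≤ (max k l : ℕ) := by exact_mod_cast le_max_right k l
        refine ⟨lt_of_le_of_lt ?_ hk, h2, by linarith⟩
        gcongr
      exact ⟨_, h3⟩
  have hlim : Tendsto (fun k => ν.real (U k)) atTop (𝓝 (ν.real {w | 0 < e * w.1 ∧ 1 < w.2})) := by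
    rw [← hUnion]
    exact (ENNReal.tendsto_toReal (measure_ne_top ν _)).comp
      (tendsto_measure_iUnion_atTop hUmono)
  have hνρ : ν.real {w | 0 < e * w.1 ∧ 1 < w.2} = ρ.real {w | 0 < e * w.1 ∧ 1 < w.2} := by
    rw [measureReal_def, measureReal_def, hν, Measure.restrict_apply' hHm, inter_eq_left.2]
    exact fun w hw => ⟨mem_univ _, hw.2⟩
  rw [hνρ] at hlim
  obtain ⟨k, hk⟩ := (hlim.eventually_const_lt
    (show ρ.real {w | 0 < e * w.1 ∧ 1 < w.2} - η <
      ρ.real {w | 0 < e * w.1 ∧ 1 < w.2} by linarith)).exists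
  obtain ⟨K, hKU, hK, hKlt⟩ : ∃ K ⊆ U k, IsClosed K ∧
      ρ.real {w | 0 < e * w.1 ∧ 1 < w.2} - η < ν.real K := by
    rcases lt_or_ge (ρ.real {w | 0 < e * w.1 ∧ 1 < w.2} - η) 0 with h | h
    · exact ⟨∅, empty_subset _, isClosed_empty, by simpa using h⟩
    · obtain ⟨K, hKU, hK, hlt⟩ := (hUo k).exists_lt_isClosed
        ((ENNReal.ofReal_lt_iff_lt_toReal h (measure_ne_top ν _)).2 hk)
      exact ⟨K, hKU, hK, (ENNReal.ofReal_lt_iff_lt_toReal h (measure_ne_top ν _)).1 hlt⟩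
  -- A Urysohn function that is one on `K` and vanishes off `U k`; its integral is at least the mass
  -- of `K`.
  obtain ⟨u, hu0, hu1, hu⟩ := exists_continuous_zero_one_of_isClosed (hUo k).isClosed_compl hK
    (disjoint_left.2 fun w hw hw' => hw (hKU hw'))
  let φ : (ℝ × ℝ) →ᵇ ℝ := BoundedContinuousFunction.ofNormedAddCommGroup u u.continuous 1
    (fun w => by
      rw [Real.norm_eq_abs, abs_of_nonneg (hu w).1]
      exact (hu w).2)
  have hφU : ∀ w, φ w ≠ 0 → w ∈ U k := fun w hw => by
    by_contra h
    exact hw (hu0 h)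
  refine ⟨1 / ((k : ℝ) + 1), (k : ℝ) + 1, φ, by positivity, by positivity,
    fun w => (hu w).2, hφU, hKlt.trans_le ?_⟩
  have h1 : ∫ w, φ w ∂ρ = ∫ w, φ w ∂ν := by
    refine (setIntegral_eq_integral_of_forall_compl_eq_zero fun w hw => ?_).symm
    by_contra h
    exact hw ⟨mem_univ _, (hφU w h).2.1⟩
  rw [h1, ← integral_indicator_one hK.measurableSet]
  refine integral_mono ((integrable_const (1 : ℝ)).indicator hK.measurableSet)
    (φ.integrable ν) fun w => ?_
  refine indicator_le' (f := (1 : ℝ × ℝ → ℝ)) (g := φ) (fun z hz => (hu1 hz).ge)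
    (fun z _ => (hu z).1) w

lemma IsRestrictionNearInfinity.eventually_le [IsFiniteMeasure πs]
    {D : Set (ℝ × ℝ)} (hπ : IsRestrictionNearInfinity π πs D) :
    ∀ᶠ s in atTop, ∀ A : Set (ℝ × ℝ), MeasurableSet A → (∀ z ∈ A, s ≤ ‖z‖) →
      π.real A ≤ πs.real A := by
  obtain ⟨R, hR⟩ := hπ
  filter_upwards [eventually_gt_atTop R] with s hs A hA h
  rw [measureReal_def, hR A hA fun z hz => hs.trans_le (h z hz)]
  exact measureReal_mono inter_subset_left

/-- The test function is supported in a bounded set at positive distance from the axes. Scaled by `c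
n`, this set lies in a cone which `D` contains far out, so `π` and `πs` agree there and the mass of
`πs` survives the deletion. -/
lemma exists_le_measureReal_sector [IsProbabilityMeasure πs] [IsProbabilityMeasure π]
    (hf : IsSymmetricDensity f) (hdom : DominatedTail (distFun f))
    (hπs : InDomain πs ρ (distFun f)) (hρ : ρ (univ ×ˢ Ioi 1) = 1)
    (hπ : IsRestrictionNearInfinity π πs (diagonalRegion (distFun f) n₀))
    {e : ℝ} (he : |e| = 1) {η : ℝ} (hη : 0 < η) :
    ∃ δ : ℝ, 0 < δ ∧ ∀ᶠ s in atTop,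
      (ρ.real {w | 0 < e * w.1 ∧ 1 < w.2} - η) * (1 - distFun f s) ≤
        π.real {z | δ * s < e * z.1 ∧ s ≤ z.2} := by
  obtain ⟨c, hc, hconv⟩ := hπs
  have hc_top := hf.tendsto_scaling hc
  set η' := η / 5 with hη'
  have hη0 : 0 < η' := by positivity
  obtain ⟨δ, M, φ, hδ, hM, hφ1, hφU, hφρ⟩ := exists_integral_sector_gt hρ e hη0
  have hconv' := hconv 1 one_pos φ (fun w hw => by
    by_contra h
    rw [mem_ball_zero_iff] at hw
    linarith [(hφU w h).2.1, le_abs_self w.2, norm_snd_le w, Real.norm_eq_abs w.2])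
  -- On the scaled support `|z.1| > δ c_n`, `|z.2| > c_n` and `max |z.1| |z.2| < M c_n`, so this is
  -- a lower bound for the ratio of the smaller to the larger coordinate.
  have hκ : 0 < min δ 1 / M := by positivity
  obtain ⟨R, hR⟩ := exists_mem_diagonalRegion hf hdom n₀ hκ
  obtain ⟨R', hR'⟩ := hπ
  -- This `n` makes `c_n` slightly larger than `s`, so that the scaled support lies in the sector at
  -- level `s`, while `n (1 - F(s)) ≤ 1 + 2 η'`, so that little is lost. As the sector mass is at
  -- most one, the total loss stays below `5 η' = η`.
  have h4 : Tendsto (fun s => ⌈(1 + η') * (1 - distFun f s)⁻¹⌉₊) atTop atTop :=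
    tendsto_nat_ceil_atTop.comp (Tendsto.const_mul_atTop (by positivity)
      ((tendsto_inv_nhdsGT_zero).comp (tendsto_nhdsWithin_iff.2
        ⟨hf.tendsto_tail, .of_forall hf.tail_pos⟩)))
  refine ⟨δ, hδ, ?_⟩
  filter_upwards [h4.eventually (hconv'.eventually_const_lt hφρ),
    h4.eventually (hc.eventually_lt_const (show (1 : ℝ) < 1 + η' by linarith)),
    h4.eventually (hc_top.eventually_gt_atTop R), h4.eventually (hc_top.eventually_gt_atTop R'),
    h4.eventually (hc_top.eventually_gt_atTop 0),
    hf.tendsto_tail.eventually_le_const hη0] with s h5 h6 h7 h8 h9 h10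
  set n := ⌈(1 + η') * (1 - distFun f s)⁻¹⌉₊
  have hT := hf.tail_pos s
  have h11 : 1 + η' ≤ (n : ℝ) * (1 - distFun f s) := by
    have h := mul_le_mul_of_nonneg_right (Nat.le_ceil ((1 + η') * (1 - distFun f s)⁻¹)) hT.le
    rwa [mul_assoc, inv_mul_cancel₀ hT.ne', mul_one] at h
  have h12 : (n : ℝ) * (1 - distFun f s) ≤ 1 + 2 * η' := by
    have h := mul_le_mul_of_nonneg_right
      (Nat.ceil_lt_add_one (show 0 ≤ (1 + η') * (1 - distFun f s)⁻¹ by positivity)).le hT.le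
    rw [add_mul (_ * _), mul_assoc (1 + η'), inv_mul_cancel₀ hT.ne', mul_one] at h
    linarith
  have hn : (0 : ℝ) < n := by
    by_contra h
    nlinarith
  have hs : s < c n := by
    rw [← hf.tail_lt_tail_iff]
    exact lt_of_mul_lt_mul_left (h6.trans_le h11) hn.le
  have hcont : Continuous fun z : ℝ × ℝ => φ (z.1 / c n, z.2 / c n) := by fun_prop
  set A : Set (ℝ × ℝ) := {z | φ (z.1 / c n, z.2 / c n) ≠ 0} with hA
  have hAm : MeasurableSet A := (isOpen_ne_fun hcont continuous_const).measurableSet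
  have hAU : ∀ z ∈ A, δ * c n < e * z.1 ∧ c n < z.2 ∧ max |z.1| |z.2| < M * c n := by
    intro z hz
    obtain ⟨h13, h14, h15⟩ := hφU _ hz
    simp only [Prod.norm_mk, Real.norm_eq_abs, abs_div, abs_of_pos h9] at h13 h14 h15
    rw [← mul_div_assoc, lt_div_iff₀ h9] at h13
    rw [lt_div_iff₀ h9, one_mul] at h14
    rw [max_lt_iff, div_lt_iff₀ h9, div_lt_iff₀ h9] at h15
    exact ⟨h13, h14, max_lt h15.1 h15.2⟩
  have h16 : ∫ z, φ (z.1 / c n, z.2 / c n) ∂πs ≤ πs.real A := by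
    rw [← integral_indicator_one hAm]
    refine integral_mono (Integrable.of_bound hcont.aestronglyMeasurable ‖φ‖
      (.of_forall fun z => φ.norm_coe_le_norm _))
      ((integrable_const (1 : ℝ)).indicator hAm) fun z => ?_
    by_cases hz : z ∈ A
    · rw [indicator_of_mem hz]
      exact hφ1 _
    · rw [indicator_of_notMem hz]
      exact (not_not.1 hz).le
  have hmax : ∀ z ∈ A, c n < max |z.1| |z.2| := fun z hz =>
    (hAU z hz).2.1.trans_le ((le_abs_self _).trans (le_max_right _ _))
  have h17 : π.real A = πs.real A := by
    rw [measureReal_def, hR' A hAm (fun z hz => h8.trans (hmax z hz)), measureReal_def,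
      inter_eq_left.2]
    intro z hz
    obtain ⟨h13, h14, h15⟩ := hAU z hz
    refine hR z (h7.trans (hmax z hz)).le ?_
    have h18 : min δ 1 / M * max |z.1| |z.2| ≤ min δ 1 * c n := by
      rw [div_mul_eq_mul_div, div_le_iff₀ hM, mul_assoc, mul_comm (c n)]
      gcongr
    have h19 : e * z.1 ≤ |z.1| := by
      have := le_abs_self (e * z.1)
      rwa [abs_mul, he, one_mul] at this
    refine h18.trans (le_min ?_ ?_)
    · exact (mul_le_mul_of_nonneg_right (min_le_left _ _) h9.le).trans (h13.le.trans h19)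
    · refine (mul_le_mul_of_nonneg_right (min_le_right _ _) h9.le).trans ?_
      rw [one_mul]
      exact h14.le.trans (le_abs_self _)
  have h20 : π.real A ≤ π.real {z | δ * s < e * z.1 ∧ s ≤ z.2} := by
    refine measureReal_mono fun z hz => ?_
    obtain ⟨h13, h14, -⟩ := hAU z hz
    exact ⟨lt_trans (by gcongr) h13, (hs.trans h14).le⟩
  have h21 : ρ.real {w | 0 < e * w.1 ∧ 1 < w.2} ≤ 1 := by
    have h23 : ρ.real (univ ×ˢ Ioi 1) = 1 := by simp [measureReal_def, hρ]
    exact (measureReal_mono (s₂ := univ ×ˢ Ioi 1) (fun w hw => ⟨mem_univ _, hw.2⟩)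
      (by simp [hρ])).trans_eq h23
  rcases le_total (ρ.real {w | 0 < e * w.1 ∧ 1 < w.2} - η) 0 with h22 | h22
  · exact (mul_nonpos_of_nonpos_of_nonneg h22 hT.le).trans measureReal_nonneg
  · refine le_trans ?_ (h16.trans (h17.symm.le.trans h20))
    refine le_of_mul_le_mul_left (le_trans ?_ h5.le) hn
    nlinarith

/-- Asymptotic description of the restricted law in the upper halfplane. -/
lemma eventually_measureReal_snd_ge_le [IsProbabilityMeasure πs]
    (hf : IsSymmetricDensity f) (htail : TailAsymptotic (πs.map Prod.snd) (distFun f))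
    {D : Set (ℝ × ℝ)} (hπ : IsRestrictionNearInfinity π πs D)
    {η : ℝ} (hη : 0 < η) :
    ∀ᶠ s in atTop, π.real {z | s ≤ z.2} ≤ (1 + η) * (1 - distFun f s) := by
  have : IsProbabilityMeasure (πs.map Prod.snd) := Measure.isProbabilityMeasure_map (by fun_prop)
  filter_upwards [htail.eventually_Ici_le hf hη, hπ.eventually_le] with s h1 h2
  refine (h2 _ (measurableSet_le measurable_const measurable_snd) fun z hz => ?_).trans ?_
  · exact le_trans (le_trans hz (le_abs_self _)) (norm_snd_le z)
  · rwa [map_measureReal_apply measurable_snd measurableSet_Ici] at h1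

lemma eventually_measureReal_abs_fst_ge_le [IsProbabilityMeasure πs]
    (hf : IsSymmetricDensity f) (htail : TailAsymptotic (πs.map Prod.fst) (distFun f))
    {D : Set (ℝ × ℝ)} (hπ : IsRestrictionNearInfinity π πs D) :
    ∀ᶠ s in atTop, π.real {z | s ≤ |z.1|} ≤ 4 * (1 - distFun f s) := by
  have : IsProbabilityMeasure (πs.map Prod.fst) := Measure.isProbabilityMeasure_map (by fun_prop)
  -- Each of the two rays contributes a factor `1 + 1`; only the order of magnitude is used later.
  filter_upwards [htail.eventually_Ici_le hf one_pos, htail.eventually_Iic_le hf one_pos,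
    hπ.eventually_le] with s h1 h2 h3
  refine (h3 _ (measurableSet_le measurable_const (by fun_prop)) fun z hz =>
    le_trans hz (norm_fst_le z)).trans ?_
  rw [map_measureReal_apply measurable_fst measurableSet_Ici] at h1
  rw [map_measureReal_apply measurable_fst measurableSet_Iic] at h2
  have h4 : πs.real {z | s ≤ |z.1|} ≤
      πs.real (Prod.fst ⁻¹' Ici s) + πs.real (Prod.fst ⁻¹' Iic (-s)) := by
    refine (measureReal_mono fun z hz => ?_).trans (measureReal_union_le _ _)
    rcases le_abs.1 (show s ≤ |z.1| from hz) with h | h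
    · exact Or.inl h
    · exact Or.inr (by simp only [mem_preimage, mem_Iic]; linarith)
  linarith

end Sector

/-- The law `π` is asymptotically concentrated, in the upper halfplane, on the sectors
`δ * s < z.1` and `δ * s < -z.1`, with relative masses `m 1` and `m (-1)`. -/
structure HasSectorTails (π : Measure (ℝ × ℝ)) (F : ℝ → ℝ) (m : ℝ → ℝ) : Prop where
  sum_eq_one : m 1 + m (-1) = 1
  sector : ∀ e : ℝ, |e| = 1 → ∀ η : ℝ, 0 < η → ∃ δ : ℝ, 0 < δ ∧ ∀ᶠ s in atTop,
    (m e - η) * (1 - F s) ≤ π.real {z | δ * s < e * z.1 ∧ s ≤ z.2}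
  upper : ∀ η : ℝ, 0 < η → ∀ᶠ s in atTop, π.real {z | s ≤ z.2} ≤ (1 + η) * (1 - F s)
  lateral : ∀ᶠ s in atTop, π.real {z | s ≤ |z.1|} ≤ 4 * (1 - F s)

namespace HasSectorTails

variable {π μ : Measure (ℝ × ℝ)} {f g ψ : ℝ → ℝ} {m : ℝ → ℝ}

lemma sum_neg (h : HasSectorTails π (distFun f) m) {e : ℝ} (he : |e| = 1) :
    m e + m (-e) = 1 := by
  rcases (abs_eq zero_le_one).1 he with rfl | rfl
  · exact h.sum_eq_one
  · rw [neg_neg, add_comm]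
    exact h.sum_eq_one

lemma sector_add_le [IsFiniteMeasure π] {a s e : ℝ} (ha : 0 ≤ a) :
    π.real {z | a < e * z.1 ∧ s ≤ z.2} + π.real {z | a < -e * z.1 ∧ s ≤ z.2} ≤
      π.real {z | s ≤ z.2} := by
  rw [← measureReal_union _ (measurableSet_sector (-e) a s)]
  · refine measureReal_mono fun z hz => ?_
    rcases hz with hz | hz
    · exact hz.2
    · exact hz.2
  · rw [disjoint_left]
    rintro z ⟨h1, -⟩ ⟨h2, -⟩
    rw [neg_mul] at h2
    linarith

lemma eventually_sector_ge [IsFiniteMeasure π] (h : HasSectorTails π (distFun f) m)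
    {e : ℝ} (he : |e| = 1) {η : ℝ} (hη : 0 < η) :
    ∀ᶠ s in atTop, (m e - η) * (1 - distFun f s) ≤ π.real {z | 0 < e * z.1 ∧ s ≤ z.2} := by
  obtain ⟨δ, hδ, h1⟩ := h.sector e he η hη
  filter_upwards [h1, eventually_ge_atTop 0] with s hs h0
  exact hs.trans (measureReal_mono fun z hz => ⟨lt_of_le_of_lt (by positivity) hz.1, hz.2⟩)

/-- The upper bound comes for free: the mass of the halfplane minus the lower bound for the opposite
sector is `1 - m (-e) = m e` in the limit. -/
lemma tendsto_sector [IsFiniteMeasure π] (h : HasSectorTails π (distFun f) m)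
    (hf : IsSymmetricDensity f) {e : ℝ} (he : |e| = 1) :
    Tendsto (fun s => π.real {z | 0 < e * z.1 ∧ s ≤ z.2} / (1 - distFun f s)) atTop
      (𝓝 (m e)) := by
  rw [Metric.tendsto_nhds]
  intro ε hε
  filter_upwards [h.eventually_sector_ge he (half_pos hε),
    h.eventually_sector_ge (e := -e) (by rwa [abs_neg]) (show 0 < ε / 4 by positivity),
    h.upper (ε / 4) (by positivity)] with s h1 h2 h3
  have hT := hf.tail_pos s
  have h4 := sector_add_le (π := π) (s := s) (e := e) le_rfl
  have h5 := h.sum_neg he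
  rw [Real.dist_eq, abs_lt, lt_sub_iff_add_lt, sub_lt_iff_lt_add, lt_div_iff₀ hT, div_lt_iff₀ hT]
  constructor
  · nlinarith
  · have h6 : (1 + ε / 4) * (1 - distFun f s) - (m (-e) - ε / 4) * (1 - distFun f s) =
        (m e + ε / 2) * (1 - distFun f s) := by
      rw [← h5]
      ring
    nlinarith

lemma tendsto_upper [IsFiniteMeasure π] (h : HasSectorTails π (distFun f) m)
    (hf : IsSymmetricDensity f) :
    Tendsto (fun s => π.real {z | s ≤ z.2} / (1 - distFun f s)) atTop (𝓝 1) := by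
  have h1 := (h.tendsto_sector hf abs_one).add (h.tendsto_sector hf (e := -1) (by simp))
  rw [h.sum_eq_one] at h1
  rw [tendsto_order]
  constructor
  · intro b hb
    filter_upwards [h1.eventually_const_lt hb] with s hs
    refine hs.trans_le ?_
    rw [← add_div]
    exact div_le_div_of_nonneg_right (sector_add_le le_rfl) (hf.tail_pos s).le
  · intro b hb
    filter_upwards [h.upper ((b - 1) / 2) (by linarith)] with s hs
    rw [div_lt_iff₀ (hf.tail_pos s)]
    nlinarith [hf.tail_pos s]

/-- The halfplane has relative mass at most `1 + η/3` and the two sectors together at least `1 -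
2η/3`, which leaves at most `η` for the cone around the vertical axis. -/
lemma exists_axis_le [IsFiniteMeasure π] (h : HasSectorTails π (distFun f) m)
    {η : ℝ} (hη : 0 < η) :
    ∃ δ : ℝ, 0 < δ ∧ ∀ᶠ s in atTop,
      π.real {z | |z.1| ≤ δ * s ∧ s ≤ z.2} ≤ η * (1 - distFun f s) := by
  obtain ⟨δ₁, hδ₁, h1⟩ := h.sector 1 abs_one (η / 3) (by positivity)
  obtain ⟨δ₂, hδ₂, h2⟩ := h.sector (-1) (by simp) (η / 3) (by positivity)
  refine ⟨min δ₁ δ₂, by positivity, ?_⟩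
  filter_upwards [h1, h2, h.upper (η / 3) (by positivity), eventually_ge_atTop 0]
    with s h3 h4 h5 h0
  have h6 : π.real {z | |z.1| ≤ min δ₁ δ₂ * s ∧ s ≤ z.2} +
      π.real {z | δ₁ * s < 1 * z.1 ∧ s ≤ z.2} + π.real {z | δ₂ * s < -1 * z.1 ∧ s ≤ z.2} ≤
      π.real {z | s ≤ z.2} := by
    rw [← measureReal_union _ (measurableSet_sector 1 _ s),
      ← measureReal_union _ (measurableSet_sector (-1) _ s)]
    · refine measureReal_mono fun z hz => ?_
      rcases hz with (hz | hz) | hz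
      · exact hz.2
      · exact hz.2
      · exact hz.2
    · rw [disjoint_left]
      rintro z hz ⟨h8, -⟩
      have h9 : min δ₁ δ₂ * s ≤ δ₂ * s := by gcongr; exact min_le_right _ _
      rcases hz with ⟨h7, -⟩ | ⟨h7, -⟩
      · linarith [neg_abs_le z.1]
      · nlinarith
    · rw [disjoint_left]
      rintro z ⟨h7, -⟩ ⟨h8, -⟩
      have h9 : min δ₁ δ₂ * s ≤ δ₁ * s := by gcongr; exact min_le_left _ _
      linarith [le_abs_self z.1]
  have h7 : (m 1 - η / 3) * (1 - distFun f s) + (m (-1) - η / 3) * (1 - distFun f s) =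
      (1 - 2 * η / 3) * (1 - distFun f s) := by
    linear_combination (1 - distFun f s) * h.sum_eq_one
  linarith

/-! ### The meta distribution in horizontal halfplanes -/

section Meta

lemma measureReal_meta_sector (hf : IsSymmetricDensity f) (hg : IsSymmetricDensity g)
    (hμ : IsMetaDistribution μ π f g) {e : ℝ} (he : |e| = 1) (s : ℝ) :
    μ.real {x | 0 < e * x.1 ∧ s ≤ x.2} = π.real {z | 0 < e * z.1 ∧ metaCoord f g s ≤ z.2} := by
  rw [← hμ.measureReal_eq (measurableSet_sector e 0 (metaCoord f g s))]
  congr 1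
  ext x
  refine and_congr ?_ (hf.strictMono_metaCoord hg).le_iff_le.symm
  rcases (abs_eq zero_le_one).1 he with rfl | rfl
  · simp [metaMap, hf.metaCoord_pos_iff hg]
  · rw [neg_one_mul, neg_one_mul, ← hf.metaCoord_pos_iff hg, hf.metaCoord_neg hg]
    rfl

lemma measureReal_meta_upper (hf : IsSymmetricDensity f) (hg : IsSymmetricDensity g)
    (hμ : IsMetaDistribution μ π f g) (s : ℝ) :
    μ.real (upperHalfplane s) = π.real {z | metaCoord f g s ≤ z.2} := by
  rw [← hμ.measureReal_eq (measurableSet_le measurable_const measurable_snd)]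
  congr 1
  ext x
  exact (hf.strictMono_metaCoord hg).le_iff_le.symm

variable [IsProbabilityMeasure π]

lemma measure_upperHalfplane_ne_zero (h : HasSectorTails π (distFun f) m)
    (hf : IsSymmetricDensity f) (hg : IsSymmetricDensity g)
    (hμ : IsMetaDistribution μ π f g) (t : ℝ) : μ (upperHalfplane t) ≠ 0 := by
  have h1 := (hf.tendsto_metaCoord hg).eventually
    ((h.tendsto_upper hf).eventually_const_lt one_pos)
  obtain ⟨s, hs, hts⟩ := (h1.and (eventually_ge_atTop t)).exists
  rw [← measureReal_meta_upper hf hg hμ] at hs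
  intro h0
  have h2 : μ (upperHalfplane s) = 0 :=
    measure_mono_null (fun x hx => le_trans hts (show s ≤ x.2 from hx)) h0
  rw [measureReal_def, h2] at hs
  simp at hs

/-- Since `1 - F(K₀(s)) = 1 - G(s)`, the sector limit at the level `K₀(t + a(t) v)` multiplies with
the von Mises limit. -/
lemma tendsto_meta_sector (h : HasSectorTails π (distFun f) m)
    (hf : IsSymmetricDensity f) (hg : IsSymmetricDensity g)
    (hψ : IsVonMises ψ) (hgψ : Tendsto (fun s => g s / Real.exp (-ψ s)) atTop (𝓝 1))
    (hμ : IsMetaDistribution μ π f g) {e : ℝ} (he : |e| = 1) (v : ℝ) :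
    Tendsto (fun t => μ.real {x | 0 < e * x.1 ∧ t + scaleFun ψ t * v ≤ x.2} /
      (1 - distFun g t)) atTop (𝓝 (m e * Real.exp (-v))) := by
  have h1 := ((h.tendsto_sector hf he).comp (hf.tendsto_metaCoord hg)).comp
    (hψ.tendsto_add_scaleFun_mul v)
  refine (h1.mul (hψ.tendsto_tail_div hg hgψ v)).congr fun t => ?_
  simp only [Function.comp_apply]
  rw [measureReal_meta_sector hf hg hμ he, hf.distFun_metaCoord hg,
    div_mul_div_cancel₀ (hg.tail_pos _).ne']

lemma tendsto_meta_upper (h : HasSectorTails π (distFun f) m)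
    (hf : IsSymmetricDensity f) (hg : IsSymmetricDensity g)
    (hψ : IsVonMises ψ) (hgψ : Tendsto (fun s => g s / Real.exp (-ψ s)) atTop (𝓝 1))
    (hμ : IsMetaDistribution μ π f g) (v : ℝ) :
    Tendsto (fun t => μ.real (upperHalfplane (t + scaleFun ψ t * v)) / (1 - distFun g t)) atTop
      (𝓝 (Real.exp (-v))) := by
  have h1 := ((h.tendsto_upper hf).comp (hf.tendsto_metaCoord hg)).comp
    (hψ.tendsto_add_scaleFun_mul v)
  have h2 := h1.mul (hψ.tendsto_tail_div hg hgψ v)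
  rw [one_mul] at h2
  refine h2.congr fun t => ?_
  simp only [Function.comp_apply]
  rw [measureReal_meta_upper hf hg hμ, hf.distFun_metaCoord hg,
    div_mul_div_cancel₀ (hg.tail_pos _).ne']

/-- In high halfplanes `y ≥ t`, the absolute horizontal coordinate is close to `t`. -/
lemma tendsto_meta_off_diagonal [IsProbabilityMeasure μ] (h : HasSectorTails π (distFun f) m)
    (hdom : DominatedTail (distFun f))
    (hf : IsSymmetricDensity f) (hg : IsSymmetricDensity g)
    (hψ : IsVonMises ψ) (hgψ : Tendsto (fun s => g s / Real.exp (-ψ s)) atTop (𝓝 1))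
    (hμ : IsMetaDistribution μ π f g) (v : ℝ) {ε : ℝ} (hε : 0 < ε) :
    Tendsto (fun t => μ.real {x | ε * t ≤ |(|x.1| - t)| ∧ t + scaleFun ψ t * v ≤ x.2} /
      (1 - distFun g t)) atTop (𝓝 0) := by
  rw [tendsto_order]
  refine ⟨fun b hb => .of_forall fun t => hb.trans_le
    (div_nonneg measureReal_nonneg (hg.tail_pos t).le), fun b hb => ?_⟩
  -- The budget `b` is halved: the part near the vertical axis costs `η (e^{-v} + 1) = b / 2`, the
  -- lateral part `4 * (b / 8)`.
  set η : ℝ := b / (2 * (Real.exp (-v) + 1)) with hη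
  have hη0 : 0 < η := by positivity
  obtain ⟨δ, hδ, h1⟩ := h.exists_axis_le hη0
  obtain ⟨C, hC, h2⟩ := hdom δ hδ
  have hr : Tendsto (fun t => metaCoord f g (t + scaleFun ψ t * v)) atTop atTop :=
    (hf.tendsto_metaCoord hg).comp (hψ.tendsto_add_scaleFun_mul v)
  have hr' : Tendsto (fun t => metaCoord f g ((1 + ε) * t)) atTop atTop :=
    (hf.tendsto_metaCoord hg).comp (tendsto_id.const_mul_atTop (by positivity))
  filter_upwards [hr.eventually h1, hr.eventually h2, hr'.eventually h.lateral,
    (hψ.tendsto_tail_mul_div_atTop hg hgψ hε v).eventually_gt_atTop C,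
    (hψ.tendsto_tail_mul_div hg hgψ hε).eventually_lt_const (show 0 < b / 8 by positivity),
    (hψ.tendsto_tail_div hg hgψ v).eventually_lt_const (lt_add_one (Real.exp (-v)))]
    with t h3 h4 h5 h6 h7 h8
  set s := t + scaleFun ψ t * v
  rw [hf.distFun_metaCoord hg] at h3 h4 h5
  rw [lt_div_iff₀ (hg.tail_pos _)] at h6
  rw [div_lt_iff₀ (hg.tail_pos _)] at h7 h8 ⊢
  -- The comparison is made through tails: the tail of `F` at `δ K₀(s)` is at most `C (1 - G(s))` by
  -- dominated variation, and rapid variation makes `1 - G((1 - ε) t)` larger than that. Hence `|x|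
  -- ≤ (1 - ε) t` is mapped into the thin cone around the vertical axis.
  have h9 : metaCoord f g ((1 - ε) * t) ≤ δ * metaCoord f g s := by
    rw [← hf.tail_le_tail_iff, hf.distFun_metaCoord hg]
    exact h4.trans h6.le
  have hm1 : MeasurableSet {z : ℝ × ℝ | metaCoord f g ((1 + ε) * t) ≤ |z.1|} :=
    measurableSet_le measurable_const (by fun_prop)
  have hm2 : MeasurableSet {z : ℝ × ℝ | |z.1| ≤ δ * metaCoord f g s ∧ metaCoord f g s ≤ z.2} :=
    (measurableSet_le continuous_fst.abs.measurable measurable_const).inter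
      (measurableSet_le measurable_const measurable_snd)
  have h10 : μ.real {x | ε * t ≤ |(|x.1| - t)| ∧ s ≤ x.2} ≤
      π.real {z | metaCoord f g ((1 + ε) * t) ≤ |z.1|} +
        π.real {z | |z.1| ≤ δ * metaCoord f g s ∧ metaCoord f g s ≤ z.2} := by
    rw [← hμ.measureReal_eq hm1, ← hμ.measureReal_eq hm2]
    refine (measureReal_mono fun x hx => ?_).trans (measureReal_union_le _ _)
    have hmono := (hf.strictMono_metaCoord hg).monotone
    rcases le_abs.1 hx.1 with h11 | h11
    · left
      change metaCoord f g ((1 + ε) * t) ≤ |metaCoord f g x.1|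
      rw [hf.abs_metaCoord hg]
      exact hmono (by linarith)
    · right
      refine ⟨?_, hmono hx.2⟩
      change |metaCoord f g x.1| ≤ _
      rw [hf.abs_metaCoord hg]
      exact (hmono (by linarith)).trans h9
  have h11 : η * (1 - distFun g s) < b / 2 * (1 - distFun g t) := by
    calc η * (1 - distFun g s) < η * ((Real.exp (-v) + 1) * (1 - distFun g t)) := by gcongr
      _ = b / 2 * (1 - distFun g t) := by
        rw [hη]
        field_simp
  linarith

end Meta

end HasSectorTails

/-! ### Weak convergence to a law on two vertical lines -/

lemma expIntensity_Ici (v : ℝ) : expIntensity (Ici v) = ENNReal.ofReal (Real.exp (-v)) := by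
  rw [expIntensity, withDensity_apply _ measurableSet_Ici, setLIntegral_congr Ioi_ae_eq_Ici.symm,
    ← ofReal_integral_eq_lintegral_ofReal (integrableOn_exp_neg_Ioi v)
      (.of_forall fun x => (Real.exp_pos _).le), integral_exp_neg_Ioi]

/-- The law of `v₀ + V` with `V` standard exponential. -/
def shiftedExp (v₀ : ℝ) : Measure ℝ :=
  ENNReal.ofReal (Real.exp v₀) • expIntensity.restrict (Ici v₀)

lemma shiftedExp_Ici (v₀ c : ℝ) :
    shiftedExp v₀ (Ici c) = ENNReal.ofReal (Real.exp (-max c v₀) / Real.exp (-v₀)) := by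
  rw [shiftedExp, Measure.smul_apply, Measure.restrict_apply measurableSet_Ici, Ici_inter_Ici,
    expIntensity_Ici, smul_eq_mul, ← ENNReal.ofReal_mul (Real.exp_pos _).le, Real.exp_neg v₀,
    div_inv_eq_mul, mul_comm]

instance isProbabilityMeasure_shiftedExp (v₀ : ℝ) : IsProbabilityMeasure (shiftedExp v₀) where
  measure_univ := by
    rw [shiftedExp, Measure.smul_apply, Measure.restrict_apply_univ, expIntensity_Ici, smul_eq_mul,
      ← ENNReal.ofReal_mul (Real.exp_pos _).le, ← Real.exp_add, add_neg_cancel, Real.exp_zero,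
      ENNReal.ofReal_one]

lemma shiftedExp_zero : shiftedExp 0 = expMeasure 1 := by
  have h : ∀ x, gammaPDF 1 1 x =
      (Ici (0 : ℝ)).indicator (fun v => ENNReal.ofReal (Real.exp (-v))) x := by
    intro x
    have := exponentialPDF_eq 1 x
    rw [exponentialPDF, exponentialPDFReal] at this
    rw [gammaPDF, this]
    by_cases hx : 0 ≤ x
    · simp [hx]
    · simp [hx]
  rw [shiftedExp, Real.exp_zero, ENNReal.ofReal_one, one_smul, expMeasure, gammaMeasure,
    expIntensity, restrict_withDensity measurableSet_Ici, ← withDensity_indicator measurableSet_Ici]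
  congr 1
  funext x
  exact (h x).symm

lemma isProbabilityMeasure_twoPoint {p q : ENNReal} (h : p + q = 1) :
    IsProbabilityMeasure (twoPoint p q) where
  measure_univ := by simp [twoPoint, h]

lemma twoPoint_apply (p q : ENNReal) {A : Set ℝ} (hA : MeasurableSet A) :
    twoPoint p q A = p * A.indicator 1 (-1) + q * A.indicator 1 1 := by
  simp [twoPoint, Measure.dirac_apply' _ hA]

/-- The half-open rectangles whose vertical sides avoid the lines `u = ± 1`. -/
def cellSystem : Set (Set (ℝ × ℝ)) :=
  {s | ∃ a b c d : ℝ, |a| ≠ 1 ∧ |b| ≠ 1 ∧ s = Ico a b ×ˢ Ico c d}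

lemma isPiSystem_cellSystem : IsPiSystem cellSystem := by
  rintro _ ⟨a, b, c, d, ha, hb, rfl⟩ _ ⟨a', b', c', d', ha', hb', rfl⟩ -
  refine ⟨a ⊔ a', b ⊓ b', c ⊔ c', d ⊓ d', ?_, ?_, ?_⟩
  · rcases max_choice a a' with h | h <;> rw [h] <;> assumption
  · rcases min_choice b b' with h | h <;> rw [h] <;> assumption
  · rw [prod_inter_prod, Ico_inter_Ico, Ico_inter_Ico]

lemma exists_mem_Ioo_abs_ne_one {a b : ℝ} (h : a < b) : ∃ x ∈ Ioo a b, |x| ≠ 1 := by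
  obtain ⟨x, hx, hx'⟩ := ((Ioo_infinite h).sdiff (toFinite {1, -1})).nonempty
  refine ⟨x, hx, fun h1 => hx' ?_⟩
  rcases (abs_eq zero_le_one).1 h1 with rfl | rfl <;> simp

lemma exists_cell_nhds {u : Set (ℝ × ℝ)} (hu : IsOpen u) {x : ℝ × ℝ} (hx : x ∈ u) :
    ∃ s ∈ cellSystem, s ∈ 𝓝 x ∧ s ⊆ u := by
  obtain ⟨r, hr, hball⟩ := Metric.isOpen_iff.1 hu x hx
  obtain ⟨a, ha, ha'⟩ := exists_mem_Ioo_abs_ne_one (show x.1 - r < x.1 by linarith)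
  obtain ⟨b, hb, hb'⟩ := exists_mem_Ioo_abs_ne_one (show x.1 < x.1 + r by linarith)
  refine ⟨Ico a b ×ˢ Ico (x.2 - r / 2) (x.2 + r / 2), ⟨a, b, _, _, ha', hb', rfl⟩, ?_, ?_⟩
  · exact prod_mem_nhds (Ico_mem_nhds ha.2 hb.1) (Ico_mem_nhds (by linarith) (by linarith))
  · rintro y ⟨hy1, hy2⟩
    refine hball ?_
    rw [Metric.mem_ball, Prod.dist_eq, max_lt_iff, Real.dist_eq, Real.dist_eq, abs_lt, abs_lt]
    have := hy1.1
    have := hy1.2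
    have := hy2.1
    have := hy2.2
    have := ha.1
    have := hb.2
    refine ⟨⟨?_, ?_⟩, ?_, ?_⟩ <;> linarith

lemma mem_Ico_iff_of_abs_sub_lt {a b x y ε : ℝ} (ha : ε ≤ |a - y|) (hb : ε ≤ |b - y|)
    (hx : |x - y| < ε) : x ∈ Ico a b ↔ y ∈ Ico a b := by
  rw [abs_lt] at hx
  rw [mem_Ico, mem_Ico]
  rcases le_abs.1 ha with ha | ha <;> rcases le_abs.1 hb with hb | hb <;>
    constructor <;> rintro ⟨h1, h2⟩ <;> constructor <;> linarith

/-- Laws on the plane converge weakly to a product law on the lines `u = ± 1` if they concentrate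
on these lines, and if the tails of the second coordinate converge on each line. -/
lemma tendsto_twoPoint_prod {ι : Type*} {l : Filter ι} [l.IsCountablyGenerated]
    {Q : ι → ProbabilityMeasure (ℝ × ℝ)} {κ : Measure ℝ} [IsProbabilityMeasure κ] {p q : ENNReal}
    [IsProbabilityMeasure (twoPoint p q)] (hp : p ≠ ⊤) (hq : q ≠ ⊤)
    (hneg : ∀ c, Tendsto (fun i => (Q i : Measure (ℝ × ℝ)).real {w | 0 < -1 * w.1 ∧ c ≤ w.2}) l
      (𝓝 (p.toReal * κ.real (Ici c))))
    (hpos : ∀ c, Tendsto (fun i => (Q i : Measure (ℝ × ℝ)).real {w | 0 < 1 * w.1 ∧ c ≤ w.2}) l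
      (𝓝 (q.toReal * κ.real (Ici c))))
    (hoff : ∀ ε, 0 < ε →
      Tendsto (fun i => (Q i : Measure (ℝ × ℝ)).real {w | ε ≤ |(|w.1| - 1)|}) l (𝓝 0)) :
    Tendsto Q l (𝓝 ⟨(twoPoint p q).prod κ, inferInstance⟩) := by
  refine isPiSystem_cellSystem.tendsto_probabilityMeasure_of_tendsto_of_mem ?_
    (fun u hu x hx => exists_cell_nhds hu hx) ?_
  · rintro _ ⟨a, b, c, d, -, -, rfl⟩
    exact measurableSet_Ico.prod measurableSet_Ico
  rintro _ ⟨a, b, c, d, ha, hb, rfl⟩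
  rw [← NNReal.tendsto_coe]
  change Tendsto (fun i => (Q i : Measure (ℝ × ℝ)).real (Ico a b ×ˢ Ico c d)) l
    (𝓝 (((twoPoint p q).prod κ).real (Ico a b ×ˢ Ico c d)))
  rcases lt_or_ge d c with hdc | hcd
  · simpa [Ico_eq_empty_of_le hdc.le] using tendsto_const_nhds
  -- A half strip is the difference of two quadrants, whose limits are given.
  have hstrip : ∀ (e : ℝ) (m : ℝ), (∀ c, Tendsto (fun i => (Q i : Measure (ℝ × ℝ)).real
      {w | 0 < e * w.1 ∧ c ≤ w.2}) l (𝓝 (m * κ.real (Ici c)))) →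
      Tendsto (fun i => (Q i : Measure (ℝ × ℝ)).real {w | 0 < e * w.1 ∧ w.2 ∈ Ico c d}) l
        (𝓝 (m * κ.real (Ico c d))) := by
    intro e m h
    have h1 : ∀ i, (Q i : Measure (ℝ × ℝ)).real {w | 0 < e * w.1 ∧ w.2 ∈ Ico c d} =
        (Q i : Measure (ℝ × ℝ)).real {w | 0 < e * w.1 ∧ c ≤ w.2} -
          (Q i : Measure (ℝ × ℝ)).real {w | 0 < e * w.1 ∧ d ≤ w.2} := by
      intro i
      have hsub : {w : ℝ × ℝ | 0 < e * w.1 ∧ d ≤ w.2} ⊆ {w | 0 < e * w.1 ∧ c ≤ w.2} :=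
        fun w hw => ⟨hw.1, hcd.trans hw.2⟩
      rw [← measureReal_sdiff hsub (measurableSet_sector e 0 d)]
      congr 1
      ext w
      constructor
      · rintro ⟨h2, h3, h4⟩
        exact ⟨⟨h2, h3⟩, fun h5 => absurd h5.2 (not_le.2 h4)⟩
      · rintro ⟨⟨h2, h3⟩, h4⟩
        exact ⟨h2, h3, not_le.1 fun h5 => h4 ⟨h2, h5⟩⟩
    have h2 : κ.real (Ico c d) = κ.real (Ici c) - κ.real (Ici d) := by
      rw [← measureReal_sdiff (Ici_subset_Ici.2 hcd) measurableSet_Ici, Ici_sdiff_Ici]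
    simp_rw [h1, h2, mul_sub]
    exact (h c).sub (h d)
  set A := Ico a b with hA
  set B := Ico c d with hB
  have hAm : MeasurableSet A := measurableSet_Ico
  have hlim : Tendsto (fun i =>
      (Q i : Measure (ℝ × ℝ)).real {w | 0 < -1 * w.1 ∧ w.2 ∈ B} * A.indicator 1 (-1) +
      (Q i : Measure (ℝ × ℝ)).real {w | 0 < 1 * w.1 ∧ w.2 ∈ B} * A.indicator 1 1) l
      (𝓝 (((twoPoint p q).prod κ).real (A ×ˢ B))) := by
    have h1 : ((twoPoint p q).prod κ).real (A ×ˢ B) =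
        p.toReal * κ.real B * A.indicator 1 (-1) + q.toReal * κ.real B * A.indicator 1 1 := by
      have h2 : (twoPoint p q).real A =
          p.toReal * A.indicator 1 (-1) + q.toReal * A.indicator 1 1 := by
        rw [measureReal_def, twoPoint_apply p q hAm]
        by_cases h3 : (-1 : ℝ) ∈ A <;> by_cases h4 : (1 : ℝ) ∈ A <;>
          simp [h3, h4, ENNReal.toReal_add, hp, hq]
      rw [measureReal_prod_prod, h2]
      ring
    rw [h1]
    exact ((hstrip (-1) _ hneg).mul_const _).add ((hstrip 1 _ hpos).mul_const _)
  have hdist : ∀ x y : ℝ, |x| ≠ 1 → |y| = 1 → 0 < |x - y| := by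
    intro x y hx hy
    rw [abs_pos, sub_ne_zero]
    rintro rfl
    exact hx hy
  -- A first coordinate within `ε` of a line `u = ± 1` cannot be separated from that line by a
  -- vertical side of the rectangle; `ε ≤ 1` makes its sign agree with that of the line.
  obtain ⟨ε, hε, hε1, hεa, hεb, hεa', hεb'⟩ : ∃ ε : ℝ, 0 < ε ∧ ε ≤ 1 ∧ ε ≤ |a - 1| ∧
      ε ≤ |b - 1| ∧ ε ≤ |a - -1| ∧ ε ≤ |b - -1| := by
    refine ⟨min 1 (min (min |a - 1| |b - 1|) (min |a - -1| |b - -1|)), ?_, ?_⟩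
    · have h1 := hdist a 1 ha abs_one
      have h2 := hdist b 1 hb abs_one
      have h3 := hdist a (-1) ha (by simp)
      have h4 := hdist b (-1) hb (by simp)
      positivity
    · simp
  have hBm : MeasurableSet B := measurableSet_Ico
  have hPm : ∀ e : ℝ, MeasurableSet {w : ℝ × ℝ | 0 < e * w.1 ∧ w.2 ∈ B} := fun e =>
    (measurableSet_lt measurable_const (measurable_fst.const_mul e)).inter (measurable_snd hBm)
  have hdiff : ∀ i, |(Q i : Measure (ℝ × ℝ)).real (A ×ˢ B) -
      ((Q i : Measure (ℝ × ℝ)).real {w | 0 < -1 * w.1 ∧ w.2 ∈ B} * A.indicator 1 (-1) +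
      (Q i : Measure (ℝ × ℝ)).real {w | 0 < 1 * w.1 ∧ w.2 ∈ B} * A.indicator 1 1)| ≤
      (Q i : Measure (ℝ × ℝ)).real {w | ε ≤ |(|w.1| - 1)|} := by
    intro i
    -- The half strips belonging to those lines that cross the rectangle; `W` differs from the
    -- rectangle only away from the two lines.
    set W : Set (ℝ × ℝ) :=
      {w | 0 < -1 * w.1 ∧ w.2 ∈ B} ∩ {_w | (-1 : ℝ) ∈ A} ∪
        {w | 0 < 1 * w.1 ∧ w.2 ∈ B} ∩ {_w | (1 : ℝ) ∈ A} with hW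
    have hWm : MeasurableSet W :=
      ((hPm (-1)).inter (MeasurableSet.const _)).union ((hPm 1).inter (MeasurableSet.const _))
    have h1 : (Q i : Measure (ℝ × ℝ)).real W =
        (Q i : Measure (ℝ × ℝ)).real {w | 0 < -1 * w.1 ∧ w.2 ∈ B} * A.indicator 1 (-1) +
        (Q i : Measure (ℝ × ℝ)).real {w | 0 < 1 * w.1 ∧ w.2 ∈ B} * A.indicator 1 1 := by
      rw [hW, measureReal_union _ ((hPm 1).inter (MeasurableSet.const _))]
      · by_cases h3 : (-1 : ℝ) ∈ A <;> by_cases h4 : (1 : ℝ) ∈ A <;> simp [h3, h4]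
      · rw [disjoint_left]
        rintro w ⟨⟨h2, -⟩, -⟩ ⟨⟨h3, -⟩, -⟩
        linarith
    rw [← h1]
    refine (abs_measureReal_sub_le_measureReal_symmDiff (hAm.prod hBm).nullMeasurableSet
      hWm.nullMeasurableSet).trans (measureReal_mono fun w hw => ?_)
    by_contra hN
    have hN' : |(|w.1| - 1)| < ε := not_le.1 hN
    have key : w ∈ A ×ˢ B ↔ w ∈ W := by
      rcases le_total 0 w.1 with h0 | h0
      · rw [abs_of_nonneg h0] at hN'
        have h2 := mem_Ico_iff_of_abs_sub_lt hεa hεb hN'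
        have h3 : 0 < w.1 := by linarith [(abs_lt.1 hN').1]
        constructor
        · rintro ⟨h4, h5⟩
          exact Or.inr ⟨⟨by linarith, h5⟩, h2.1 h4⟩
        · rintro (⟨⟨h4, -⟩, -⟩ | ⟨⟨-, h5⟩, h6⟩)
          · linarith
          · exact ⟨h2.2 h6, h5⟩
      · rw [abs_of_nonpos h0] at hN'
        have h7 : |w.1 - -1| < ε := by
          rwa [← abs_neg, show -(w.1 - -1) = -w.1 - 1 by ring]
        have h2 := mem_Ico_iff_of_abs_sub_lt hεa' hεb' h7
        have h3 : w.1 < 0 := by linarith [(abs_lt.1 hN').1]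
        constructor
        · rintro ⟨h4, h5⟩
          exact Or.inl ⟨⟨by linarith, h5⟩, h2.1 h4⟩
        · rintro (⟨⟨-, h5⟩, h6⟩ | ⟨⟨h4, -⟩, -⟩)
          · exact ⟨h2.2 h6, h5⟩
          · linarith
    rw [mem_symmDiff] at hw
    tauto
  have h0 := squeeze_zero_norm (fun i => (Real.norm_eq_abs _).trans_le (hdiff i)) (hoff ε hε)
  simpa using h0.add hlim

/-! ### High risk scenarios -/

lemma measurable_normInv (a : ℝ → ℝ) (t : ℝ) : Measurable (normInv a t) := by
  unfold normInv
  fun_prop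

lemma measurableSet_upperHalfplane (t : ℝ) : MeasurableSet (upperHalfplane t) :=
  measurableSet_le measurable_const measurable_snd

lemma cond_real_eq_div {μ : Measure (ℝ × ℝ)} {H : Set (ℝ × ℝ)} (hH : MeasurableSet H)
    (A : Set (ℝ × ℝ)) : (μ[|H]).real A = μ.real (H ∩ A) / μ.real H := by
  rw [measureReal_def, cond_apply hH, ENNReal.toReal_mul, ENNReal.toReal_inv, div_eq_inv_mul]
  rfl

namespace HasSectorTails

variable {π μ : Measure (ℝ × ℝ)} [IsProbabilityMeasure π] [IsProbabilityMeasure μ]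
  {f g ψ : ℝ → ℝ} {m : ℝ → ℝ} {p q : ENNReal}

/-- The high risk scenarios on the halfplanes `v ≥ v₀` converge weakly. -/
lemma tendsto_highRiskScenario (h : HasSectorTails π (distFun f) m)
    (hdom : DominatedTail (distFun f)) (hf : IsSymmetricDensity f) (hg : IsSymmetricDensity g)
    (hψ : IsVonMises ψ) (hgψ : Tendsto (fun s => g s / Real.exp (-ψ s)) atTop (𝓝 1))
    (hμ : IsMetaDistribution μ π f g) (hp : p ≠ ⊤) (hq : q ≠ ⊤)
    (hpm : m (-1) = p.toReal) (hqm : m 1 = q.toReal) [IsProbabilityMeasure (twoPoint p q)]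
    (v₀ : ℝ) {E : Type*} [RCLike E] (φ : (ℝ × ℝ) →ᵇ E) :
    Tendsto (fun t => ∫ x, φ (normInv (scaleFun ψ) t x)
      ∂(μ[|upperHalfplane (t + scaleFun ψ t * v₀)])) atTop
      (𝓝 (∫ w, φ w ∂((twoPoint p q).prod (shiftedExp v₀)))) := by
  have hprob : ∀ s, IsProbabilityMeasure (μ[|upperHalfplane s]) := fun s =>
    cond_isProbabilityMeasure (h.measure_upperHalfplane_ne_zero hf hg hμ s)
  let Q : ℝ → ProbabilityMeasure (ℝ × ℝ) := fun t =>
    ⟨(μ[|upperHalfplane (t + scaleFun ψ t * v₀)]).map (normInv (scaleFun ψ) t),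
      Measure.isProbabilityMeasure_map (measurable_normInv _ _).aemeasurable⟩
  have hQ : ∀ t (A : Set (ℝ × ℝ)), MeasurableSet A → (Q t : Measure (ℝ × ℝ)).real A =
      μ.real (upperHalfplane (t + scaleFun ψ t * v₀) ∩ normInv (scaleFun ψ) t ⁻¹' A) /
        μ.real (upperHalfplane (t + scaleFun ψ t * v₀)) := by
    intro t A hA
    rw [← cond_real_eq_div (measurableSet_upperHalfplane _),
      ← map_measureReal_apply (measurable_normInv _ _) hA]
    rfl
  have hev : ∀ᶠ t in atTop, 0 < t ∧ 0 < scaleFun ψ t :=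
    (eventually_gt_atTop 0).and (hψ.eventually_hasDerivAt.mono fun t ht => ht.2.1)
  have hupper := h.tendsto_meta_upper hf hg hψ hgψ hμ v₀
  have hsector : ∀ e : ℝ, |e| = 1 → ∀ c, Tendsto
      (fun t => (Q t : Measure (ℝ × ℝ)).real {w | 0 < e * w.1 ∧ c ≤ w.2}) atTop
      (𝓝 (m e * (shiftedExp v₀).real (Ici c))) := by
    intro e he c
    -- Conditioning on `v ≥ v₀` intersects the event `c ≤ v` to `max c v₀ ≤ v`; the common factor `1
    -- - G(t)` cancels in the quotient.
    have h1 := (h.tendsto_meta_sector hf hg hψ hgψ hμ he (max c v₀)).div hupper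
      (Real.exp_pos _).ne'
    rw [mul_div_assoc] at h1
    rw [measureReal_def, shiftedExp_Ici, ENNReal.toReal_ofReal (by positivity)]
    refine h1.congr' ?_
    filter_upwards [hev] with t ht
    simp only [Pi.div_apply]
    rw [hQ _ _ (measurableSet_sector e 0 c), div_div_div_cancel_right₀ (hg.tail_pos t).ne']
    congr 2
    ext x
    simp only [upperHalfplane, normInv, mem_ofPred_eq, mem_inter_iff, mem_preimage]
    rw [mul_max_of_nonneg _ _ ht.2.le, ← max_add_add_left, max_le_iff, le_div_iff₀ ht.2,
      ← mul_div_assoc, div_pos_iff_of_pos_right ht.1, le_sub_iff_add_le', mul_comm c]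
    tauto
  have hlim := tendsto_twoPoint_prod (l := atTop) (Q := Q) (κ := shiftedExp v₀) hp hq
    (fun c => by simpa only [hpm] using hsector (-1) (by simp) c)
    (fun c => by simpa only [hqm] using hsector 1 (by simp) c) (fun ε hε => by
      have h1 := (h.tendsto_meta_off_diagonal hdom hf hg hψ hgψ hμ v₀ hε).div hupper
        (Real.exp_pos _).ne'
      rw [zero_div] at h1
      refine h1.congr' ?_
      filter_upwards [hev] with t ht
      simp only [Pi.div_apply]
      have hm : MeasurableSet {w : ℝ × ℝ | ε ≤ |(|w.1| - 1)|} :=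
        measurableSet_le measurable_const
          (by fun_prop : Continuous fun w : ℝ × ℝ => |(|w.1| - 1)|).measurable
      rw [hQ _ _ hm, div_div_div_cancel_right₀ (hg.tail_pos t).ne']
      congr 2
      ext x
      simp only [upperHalfplane, normInv, mem_ofPred_eq, mem_inter_iff, mem_preimage]
      have h2 : |(|x.1 / t| - 1)| = |(|x.1| - t)| / t := by
        rw [abs_div, abs_of_pos ht.1, div_sub_one ht.1.ne', abs_div, abs_of_pos ht.1]
      rw [h2, le_div_iff₀ ht.1]
      exact and_comm)
  refine ((ProbabilityMeasure.tendsto_iff_forall_integral_rclike_tendsto E).1 hlim φ).congr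
    fun t => ?_
  exact integral_map (measurable_normInv _ _).aemeasurable
    φ.continuous.aestronglyMeasurable

/-- The factor `e^{-v₀}` undoes the normalization of `shiftedExp v₀`. Complex values are admitted
because the characteristic functionals require them. -/
lemma setIntegral_twoPoint_prod_expIntensity {E : Type*} [RCLike E] (p q : ENNReal)
    [IsProbabilityMeasure (twoPoint p q)] (v₀ : ℝ) (φ : ℝ × ℝ → E) :
    Real.exp (-v₀) * ∫ w, φ w ∂((twoPoint p q).prod (shiftedExp v₀)) =
      ∫ w in {w | v₀ ≤ w.2}, φ w ∂((twoPoint p q).prod expIntensity) := by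
  have h0 : SFinite expIntensity := by
    unfold expIntensity
    infer_instance
  have h1 : {w : ℝ × ℝ | v₀ ≤ w.2} = univ ×ˢ Ici v₀ := by
    ext w
    simp
  rw [h1, ← Measure.prod_restrict, Measure.restrict_univ, shiftedExp, Measure.prod_smul_right,
    integral_smul_measure, ENNReal.toReal_ofReal (Real.exp_pos _).le, RCLike.real_smul_eq_coe_mul,
    ← mul_assoc, ← RCLike.ofReal_mul, ← Real.exp_add, neg_add_cancel, Real.exp_zero,
    RCLike.ofReal_one, one_mul]

/-- The rescaled mean measures of the sample clouds converge weakly on `v ≥ v₀`. -/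
lemma tendsto_mul_setIntegral (h : HasSectorTails π (distFun f) m)
    (hdom : DominatedTail (distFun f)) (hf : IsSymmetricDensity f) (hg : IsSymmetricDensity g)
    (hψ : IsVonMises ψ) (hgψ : Tendsto (fun s => g s / Real.exp (-ψ s)) atTop (𝓝 1))
    (hμ : IsMetaDistribution μ π f g) (hp : p ≠ ⊤) (hq : q ≠ ⊤)
    (hpm : m (-1) = p.toReal) (hqm : m 1 = q.toReal) [IsProbabilityMeasure (twoPoint p q)]
    {r : ℕ → ℝ} (hr : Tendsto (fun n : ℕ => (n : ℝ) * μ.real (upperHalfplane (r n))) atTop (𝓝 1))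
    (v₀ : ℝ) {E : Type*} [RCLike E] (φ : (ℝ × ℝ) →ᵇ E) :
    Tendsto (fun n : ℕ => (n : E) * ∫ x, {w : ℝ × ℝ | v₀ ≤ w.2}.indicator φ
        (normInv (scaleFun ψ) (r n) x) ∂μ) atTop
      (𝓝 (∫ w in {w | v₀ ≤ w.2}, φ w ∂((twoPoint p q).prod expIntensity))) := by
  have hpos : ∀ t, 0 < μ.real (upperHalfplane t) := fun t =>
    ENNReal.toReal_pos (h.measure_upperHalfplane_ne_zero hf hg hμ t) (measure_ne_top _ _)
  -- If `r n` stayed below `b`, then `n μ(H_{r n})` would be at least `n μ(H_b)`, which tends to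
  -- infinity.
  have hr_top : Tendsto r atTop atTop := by
    refine Filter.tendsto_atTop.2 fun b => ?_
    have h1 : Tendsto (fun n : ℕ => (n : ℝ) * μ.real (upperHalfplane b)) atTop atTop :=
      tendsto_natCast_atTop_atTop.atTop_mul_const (hpos b)
    filter_upwards [hr.eventually_lt_const one_lt_two, h1.eventually_ge_atTop 2] with n h2 h3
    by_contra h4
    have h5 : μ.real (upperHalfplane b) ≤ μ.real (upperHalfplane (r n)) :=
      measureReal_mono fun x (hx : b ≤ x.2) => (not_le.1 h4).le.trans hx
    have h6 := mul_le_mul_of_nonneg_left h5 (Nat.cast_nonneg (α := ℝ) n)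
    linarith
  have hratio : Tendsto (fun n : ℕ => (n : ℝ) *
      μ.real (upperHalfplane (r n + scaleFun ψ (r n) * v₀))) atTop (𝓝 (Real.exp (-v₀))) := by
    have h1 := ((h.tendsto_meta_upper hf hg hψ hgψ hμ v₀).div
      (h.tendsto_meta_upper hf hg hψ hgψ hμ 0) (Real.exp_pos _).ne').comp hr_top
    have h2 := hr.mul h1
    rw [neg_zero, Real.exp_zero, div_one, one_mul] at h2
    refine h2.congr fun n => ?_
    simp only [Function.comp_apply, Pi.div_apply]
    rw [div_div_div_cancel_right₀ (hg.tail_pos _).ne', mul_zero, add_zero, mul_assoc,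
      mul_div_cancel₀ _ (hpos _).ne']
  have hint := (h.tendsto_highRiskScenario hdom hf hg hψ hgψ hμ hp hq hpm hqm v₀ φ).comp hr_top
  -- The rescaled mean measure on `v ≥ v₀` is its total mass, which tends to `e^{-v₀}`, times the
  -- conditional law.
  have hlim := ((RCLike.continuous_ofReal (K := E)).tendsto _ |>.comp hratio).mul hint
  rw [setIntegral_twoPoint_prod_expIntensity] at hlim
  refine hlim.congr' ?_
  filter_upwards [hr_top.eventually hψ.eventually_hasDerivAt] with n hn
  have ha := hn.2.1
  simp only [Function.comp_apply]
  set H := upperHalfplane (r n + scaleFun ψ (r n) * v₀) with hH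
  have hind : ∀ x, {w : ℝ × ℝ | v₀ ≤ w.2}.indicator φ (normInv (scaleFun ψ) (r n) x) =
      H.indicator (fun x => φ (normInv (scaleFun ψ) (r n) x)) x := by
    intro x
    have : normInv (scaleFun ψ) (r n) x ∈ {w : ℝ × ℝ | v₀ ≤ w.2} ↔ x ∈ H := by
      simp only [normInv, mem_ofPred_eq, hH, upperHalfplane]
      rw [le_div_iff₀ ha, le_sub_iff_add_le', mul_comm v₀]
    by_cases hx : x ∈ H
    · rw [indicator_of_mem hx, indicator_of_mem (this.2 hx)]
    · rw [indicator_of_notMem hx, indicator_of_notMem (mt this.1 hx)]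
  simp_rw [hind]
  rw [integral_indicator (measurableSet_upperHalfplane _), ProbabilityTheory.cond,
    integral_smul_measure, ENNReal.toReal_inv, RCLike.real_smul_eq_coe_mul, ← mul_assoc,
    ← RCLike.ofReal_mul]
  have h3 : (n : ℝ) * μ.real H * (μ H).toReal⁻¹ = n := by
    rw [mul_assoc]
    exact (congrArg _ (mul_inv_cancel₀ (hpos _).ne')).trans (mul_one _)
  rw [h3, RCLike.ofReal_natCast]

end HasSectorTails

/-! ### Integrals with respect to a Poisson point process -/

namespace IsPoissonProcess

variable {Ω E : Type*} [MeasurableSpace Ω] [MeasurableSpace E] {M : Ω → Measure E} {m : Measure E}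
  {P : Measure Ω}

lemma ae_lt_top (hM : IsPoissonProcess M m P) {B : Set E} (hB : MeasurableSet B) (hmB : m B ≠ ⊤) :
    ∀ᵐ ω ∂P, M ω B < ⊤ := by
  refine ((hM.poisson B hB hmB).ae_iff (p := fun x : ENNReal => x < ⊤)
    (measurableSet_setOfPred.1 measurableSet_Iio)).2 ?_
  rw [ae_map_iff (measurable_of_countable _).aemeasurable measurableSet_Iio]
  exact .of_forall fun k => ENNReal.natCast_lt_top k

lemma measurable_toReal (hM : IsPoissonProcess M m P) {A : Set E} (hA : MeasurableSet A) :
    Measurable fun ω => (M ω A).toReal :=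
  ((Measure.measurable_coe hA).comp hM.measurable).ennreal_toReal

lemma charFun_toReal_mul (hM : IsPoissonProcess M m P) {A : Set E} (hA : MeasurableSet A)
    (hmA : m A ≠ ⊤) (x ξ : ℝ) :
    charFun (P.map fun ω => (M ω A).toReal * x) ξ =
      Complex.exp (m.real A • (Complex.exp (ξ * x * Complex.I) - 1)) := by
  have h1 : P.map (fun ω => (M ω A).toReal) =
      (poissonMeasure (m A).toNNReal).map (fun k : ℕ => (k : ℝ)) := by
    have h2 := (hM.poisson A hA hmA).map_eq
    have h3 : (fun ω => (M ω A).toReal) = ENNReal.toReal ∘ fun ω => M ω A := rfl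
    have h4 : Measurable fun ω => M ω A := (Measure.measurable_coe hA).comp hM.measurable
    rw [h3, ← Measure.map_map ENNReal.measurable_toReal h4, h2,
      Measure.map_map ENNReal.measurable_toReal (measurable_of_countable _)]
    rfl
  simp_rw [mul_comm _ x]
  rw [charFun_map_mul_comp (hM.measurable_toReal hA).aemeasurable, h1,
    charFun_map_cast_poissonMeasure, Complex.real_smul]
  congr 2
  push_cast
  rw [mul_comm (x : ℂ)]

lemma integrableOn_of_bound (hM : IsPoissonProcess M m P) {B : Set E} (hB : MeasurableSet B)
    (hmB : m B ≠ ⊤) (s : SimpleFunc E ℝ) :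
    ∀ᵐ ω ∂P, Integrable s ((M ω).restrict B) := by
  filter_upwards [hM.ae_lt_top hB hmB] with ω hω
  have : IsFiniteMeasure ((M ω).restrict B) := ⟨by simpa using hω⟩
  exact s.integrable_of_isFiniteMeasure

lemma ae_integral_simpleFunc (hM : IsPoissonProcess M m P) {B : Set E} (hB : MeasurableSet B)
    (hmB : m B ≠ ⊤) (s : SimpleFunc E ℝ) :
    ∀ᵐ ω ∂P, ∫ x in B, s x ∂(M ω) =
      ∑ i : Fin s.range.card, (M ω (s ⁻¹' {(s.range.equivFin.symm i : ℝ)} ∩ B)).toReal *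
        (s.range.equivFin.symm i : ℝ) := by
  filter_upwards [hM.integrableOn_of_bound hB hmB s] with ω hω
  rw [s.integral_eq_sum hω, ← Finset.sum_coe_sort, ← Equiv.sum_comp s.range.equivFin.symm]
  refine Finset.sum_congr rfl fun i _ => ?_
  rw [measureReal_restrict_apply (s.measurableSet_fiber _), smul_eq_mul]
  rfl

/-- The counts on the disjoint level sets are independent Poisson variables, so the characteristic
functions multiply and their exponents add up to the integral of `e^{iξs} - 1`. -/
lemma charFun_integral_simpleFunc [IsProbabilityMeasure P]
    (hM : IsPoissonProcess M m P) {B : Set E} (hB : MeasurableSet B)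
    (hmB : m B ≠ ⊤) (s : SimpleFunc E ℝ) (ξ : ℝ) :
    AEMeasurable (fun ω => ∫ x in B, s x ∂(M ω)) P ∧
    charFun (P.map fun ω => ∫ x in B, s x ∂(M ω)) ξ =
      Complex.exp (∫ x in B, (Complex.exp (ξ * s x * Complex.I) - 1) ∂m) := by
  have hae := hM.ae_integral_simpleFunc hB hmB s
  set A : Fin s.range.card → Set E := fun i => s ⁻¹' {(s.range.equivFin.symm i : ℝ)} ∩ B with hA
  have hAm : ∀ i, MeasurableSet (A i) := fun i => (s.measurableSet_fiber _).inter hB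
  have hAfin : ∀ i, m (A i) ≠ ⊤ := fun i => measure_ne_top_of_subset inter_subset_right hmB
  have hdisj : Pairwise fun i j => Disjoint (A i) (A j) := by
    intro i j hij
    refine Disjoint.mono inter_subset_left inter_subset_left (Disjoint.preimage _ ?_)
    rw [disjoint_singleton]
    exact fun h => hij (s.range.equivFin.symm.injective (Subtype.ext h))
  have hmeas : ∀ i, Measurable fun ω => (M ω (A i)).toReal * (s.range.equivFin.symm i : ℝ) :=
    fun i => (hM.measurable_toReal (hAm i)).mul_const _
  refine ⟨(Finset.aemeasurable_fun_sum Finset.univ fun i _ =>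
    (hmeas i).aemeasurable).congr (EventuallyEq.symm hae), ?_⟩
  have hind : iIndepFun (fun i ω => (M ω (A i)).toReal * (s.range.equivFin.symm i : ℝ)) P :=
    (hM.indep _ A hAm hdisj).comp
      (fun i x => x.toReal * (s.range.equivFin.symm i : ℝ))
      (fun i => ENNReal.measurable_toReal.mul_const _)
  rw [Measure.map_congr hae, hind.charFun_map_fun_sum_eq_prod fun i => (hmeas i).aemeasurable,
    Finset.prod_apply]
  simp_rw [fun i => hM.charFun_toReal_mul (hAm i) (hAfin i)]
  rw [← Complex.exp_sum]
  congr 1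
  have : IsFiniteMeasure (m.restrict B) := ⟨by simpa using hmB.lt_top⟩
  have h1 := SimpleFunc.map_integral (μ := m.restrict B) s
    (fun x : ℝ => Complex.exp (ξ * x * Complex.I) - 1) s.integrable_of_isFiniteMeasure (by simp)
  rw [SimpleFunc.integral_eq_integral _ (SimpleFunc.integrable_of_isFiniteMeasure _)] at h1
  refine Eq.trans ?_ h1.symm
  rw [← Finset.sum_coe_sort s.range, ← Equiv.sum_comp s.range.equivFin.symm]
  refine Finset.sum_congr rfl fun i _ => ?_
  rw [measureReal_restrict_apply (s.measurableSet_fiber _)]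

/-- The characteristic functional of a Poisson point process. -/
lemma charFun_integral [IsProbabilityMeasure P]
    (hM : IsPoissonProcess M m P) {B : Set E} (hB : MeasurableSet B)
    (hmB : m B ≠ ⊤) {φ : E → ℝ} (hφ : StronglyMeasurable φ) {C : ℝ} (hC : ∀ x, ‖φ x‖ ≤ C) :
    AEMeasurable (fun ω => ∫ x in B, φ x ∂(M ω)) P ∧
    ∀ ξ : ℝ, charFun (P.map fun ω => ∫ x in B, φ x ∂(M ω)) ξ =
      Complex.exp (∫ x in B, (Complex.exp (ξ * φ x * Complex.I) - 1) ∂m) := by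
  -- A point of `E` is needed to see that `C ≥ 0`; on the empty space all integrals vanish.
  rcases isEmpty_or_nonempty E with hE | hE
  · have h0 : ∀ ν : Measure E, ν = 0 := fun ν => Measure.eq_zero_of_isEmpty ν
    simp_rw [fun ω => h0 (M ω), h0 m]
    refine ⟨by simp, fun ξ => ?_⟩
    simp [Measure.map_const]
  have hC0 : 0 ≤ C := (norm_nonneg _).trans (hC hE.some)
  set s : ℕ → SimpleFunc E ℝ := hφ.approxBounded C with hs
  have hs_bound : ∀ n x, ‖s n x‖ ≤ C := fun n x => hφ.norm_approxBounded_le hC0 n x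
  have hs_lim : ∀ x, Tendsto (fun n => s n x) atTop (𝓝 (φ x)) := fun x =>
    hφ.tendsto_approxBounded_of_norm_le (hC x)
  -- Almost surely `B` has finite mass, so constants dominate. The limit also yields measurability
  -- of the integral of `φ` as a function of `ω`.
  have hlim : ∀ᵐ ω ∂P, Tendsto (fun n => ∫ x in B, s n x ∂(M ω)) atTop
      (𝓝 (∫ x in B, φ x ∂(M ω))) := by
    filter_upwards [hM.ae_lt_top hB hmB] with ω hω
    have : IsFiniteMeasure ((M ω).restrict B) := ⟨by simpa using hω⟩
    exact tendsto_integral_of_dominated_convergence (fun _ => C)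
      (fun n => (s n).aestronglyMeasurable) (integrable_const C)
      (fun n => .of_forall (hs_bound n)) (.of_forall hs_lim)
  have hae : ∀ n, AEMeasurable (fun ω => ∫ x in B, s n x ∂(M ω)) P := fun n =>
    (hM.charFun_integral_simpleFunc hB hmB (s n) 0).1
  have hmeas := aemeasurable_of_tendsto_metrizable_ae atTop hae hlim
  refine ⟨hmeas, fun ξ => ?_⟩
  have h1 : Tendsto (fun n => charFun (P.map fun ω => ∫ x in B, s n x ∂(M ω)) ξ) atTop
      (𝓝 (charFun (P.map fun ω => ∫ x in B, φ x ∂(M ω)) ξ)) := by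
    have hcont : Continuous fun x : ℝ => Complex.exp (ξ * x * Complex.I) := by fun_prop
    simp_rw [charFun_apply_real]
    rw [integral_map hmeas hcont.aestronglyMeasurable]
    simp_rw [fun n => integral_map (hae n) (f := fun x : ℝ => Complex.exp (ξ * x * Complex.I))
      hcont.aestronglyMeasurable]
    refine tendsto_integral_of_dominated_convergence (fun _ => 1)
      (fun n => (hcont.measurable.comp_aemeasurable (hae n)).aestronglyMeasurable)
      (integrable_const 1) (fun n => .of_forall fun ω => ?_) ?_
    · rw [← Complex.ofReal_mul, Complex.norm_exp_ofReal_mul_I]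
    · filter_upwards [hlim] with ω hω
      exact (hcont.tendsto _).comp hω
  have h2 : Tendsto (fun n => ∫ x in B, (Complex.exp (ξ * s n x * Complex.I) - 1) ∂m) atTop
      (𝓝 (∫ x in B, (Complex.exp (ξ * φ x * Complex.I) - 1) ∂m)) := by
    have hcont : Continuous fun x : ℝ => Complex.exp (ξ * x * Complex.I) - 1 := by fun_prop
    have : IsFiniteMeasure (m.restrict B) := ⟨by simpa using hmB.lt_top⟩
    refine tendsto_integral_of_dominated_convergence (fun _ => 2)
      (fun n => (hcont.measurable.comp (s n).measurable).aestronglyMeasurable)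
      (integrable_const 2) (fun n => .of_forall fun x => ?_) (.of_forall fun x => ?_)
    · refine (norm_sub_le _ _).trans ?_
      rw [← Complex.ofReal_mul, Complex.norm_exp_ofReal_mul_I, norm_one]
      norm_num
    · exact (hcont.tendsto _).comp (hs_lim x)
  refine tendsto_nhds_unique h1 (((Complex.continuous_exp.tendsto _).comp h2).congr fun n => ?_)
  exact ((hM.charFun_integral_simpleFunc hB hmB (s n) ξ).2).symm

end IsPoissonProcess

/-! ### Convergence of sample clouds -/

section SampleCloud

lemma setIntegral_sampleCloud {Ω : Type*} (a : ℝ → ℝ) (t : ℝ) (X : ℕ → Ω → ℝ × ℝ) (n : ℕ) (ω : Ω)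
    {B : Set (ℝ × ℝ)} (hB : MeasurableSet B) (φ : ℝ × ℝ → ℝ) :
    ∫ x in B, φ x ∂(sampleCloud a t X n ω) =
      ∑ i ∈ Finset.range n, B.indicator φ (normInv a t (X i ω)) := by
  rw [← integral_indicator hB, sampleCloud, integral_finsetSum_measure]
  · simp_rw [integral_dirac]
  · exact fun i _ => integrable_dirac enorm_lt_top

variable {Ω : Type*} [MeasurableSpace Ω] {P : Measure Ω} {μ : Measure (ℝ × ℝ)}
  {X : ℕ → Ω → ℝ × ℝ}

/-- Subtracting `1` inside the integral prepares the limit `(1 + b_n)^n → exp(lim n b_n)` and gives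
an integrand that vanishes wherever `h` does. -/
lemma charFun_sampleCloud [IsProbabilityMeasure P] [IsProbabilityMeasure μ]
    (hX : ∀ i, HasLaw (X i) μ P) (hind : iIndepFun X P) {h : ℝ × ℝ → ℝ} (hh : Measurable h)
    (n : ℕ) (ξ : ℝ) :
    charFun (P.map fun ω => ∑ i ∈ Finset.range n, h (X i ω)) ξ =
      (1 + ∫ x, (Complex.exp (ξ * h x * Complex.I) - 1) ∂μ) ^ n := by
  have hmeas : ∀ i, AEMeasurable (fun ω => h (X i ω)) P := fun i =>
    hh.comp_aemeasurable (hX i).aemeasurable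
  have hind' : iIndepFun (fun i ω => h (X i ω)) P := hind.comp (fun _ => h) fun _ => hh
  have hlaw : ∀ i, charFun (P.map fun ω => h (X i ω)) ξ =
      1 + ∫ x, (Complex.exp (ξ * h x * Complex.I) - 1) ∂μ := by
    intro i
    have h1 : P.map (fun ω => h (X i ω)) = μ.map h := by
      rw [← (hX i).map_eq, AEMeasurable.map_map_of_aemeasurable hh.aemeasurable (hX i).aemeasurable]
      rfl
    have hcont : Continuous fun x : ℝ => Complex.exp (ξ * x * Complex.I) := by fun_prop
    rw [h1, charFun_apply_real, integral_map hh.aemeasurable hcont.aestronglyMeasurable,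
      integral_sub _ (integrable_const _)]
    · simp
    · refine Integrable.of_bound (hcont.measurable.comp hh).aestronglyMeasurable 1
        (.of_forall fun x => ?_)
      rw [← Complex.ofReal_mul, Complex.norm_exp_ofReal_mul_I]
  rw [(hind'.restrict _).charFun_map_fun_finsetSum_eq_prod fun i _ => hmeas i, Finset.prod_apply,
    Finset.prod_congr rfl fun i _ => hlaw i, Finset.prod_const, Finset.card_range]

/-- Sample clouds converge to a Poisson point process as soon as the rescaled mean measures
converge weakly. -/
lemma convergesWeaklyOn_sampleCloud [IsProbabilityMeasure P] [IsProbabilityMeasure μ]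
    (hX : ∀ i, HasLaw (X i) μ P) (hind : iIndepFun X P)
    {Ω' : Type*} [MeasurableSpace Ω'] {P' : Measure Ω'} [IsProbabilityMeasure P']
    {M : Ω' → Measure (ℝ × ℝ)} {m : Measure (ℝ × ℝ)} (hM : IsPoissonProcess M m P')
    {B : Set (ℝ × ℝ)} (hB : MeasurableSet B) (hmB : m B ≠ ⊤) (a : ℝ → ℝ) (r : ℕ → ℝ)
    (hconv : ∀ χ : (ℝ × ℝ) →ᵇ ℂ, Tendsto
      (fun n : ℕ => (n : ℂ) * ∫ x, B.indicator χ (normInv a (r n) x) ∂μ) atTop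
      (𝓝 (∫ w in B, χ w ∂m))) :
    ConvergesWeaklyOn (fun n => sampleCloud a (r n) X n) P M P' B := by
  intro φ
  obtain ⟨hlim, hchar⟩ := hM.charFun_integral hB hmB φ.continuous.stronglyMeasurable
    φ.norm_coe_le_norm
  have hh : ∀ n, Measurable fun x => B.indicator φ (normInv a (r n) x) := fun n =>
    (φ.continuous.measurable.indicator hB).comp (measurable_normInv a (r n))
  have hsum : ∀ n, (fun ω => ∫ x in B, φ x ∂(sampleCloud a (r n) X n ω)) =
      fun ω => ∑ i ∈ Finset.range n, B.indicator φ (normInv a (r n) (X i ω)) := fun n =>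
    funext fun ω => setIntegral_sampleCloud a (r n) X n ω hB φ
  refine ⟨fun n => ?_, hlim, ?_⟩
  · rw [hsum]
    exact Finset.aemeasurable_fun_sum _ fun i _ => (hh n).comp_aemeasurable (hX i).aemeasurable
  refine ProbabilityMeasure.tendsto_iff_tendsto_charFun.2 fun ξ => ?_
  simp only [ProbabilityMeasure.coe_mk]
  -- Convergence of mean measures is applied to `e^{iξφ} - 1`, whose integral is the exponent of the
  -- Poisson characteristic functional.
  let χ : (ℝ × ℝ) →ᵇ ℂ := BoundedContinuousFunction.ofNormedAddCommGroup
    (fun w => Complex.exp (ξ * φ w * Complex.I) - 1) (by fun_prop) 2 (fun w => by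
      refine (norm_sub_le _ _).trans ?_
      rw [← Complex.ofReal_mul, Complex.norm_exp_ofReal_mul_I, norm_one]
      norm_num)
  rw [hchar ξ]
  refine (Complex.tendsto_one_add_pow_exp_of_tendsto (hconv χ)).congr fun n => ?_
  rw [hsum, charFun_sampleCloud hX hind (hh n)]
  congr 2
  -- The indicator may be taken inside or outside the exponential, since `e^0 - 1 = 0` off `B`.
  refine integral_congr_ae (.of_forall fun x => ?_)
  by_cases hx : normInv a (r n) x ∈ B
  · simp only [indicator_of_mem hx]
    rfl
  · simp [indicator_of_notMem hx]

end SampleCloud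

/-! ### Sector tails of the restricted law -/

lemma hasSectorTails {f : ℝ → ℝ} (hf : IsSymmetricDensity f) {lam : ℝ} (hlam : 0 < lam)
    {ρ : Measure (ℝ × ℝ)} (hρ : IsExcessMeasure ρ lam) {πs : Measure (ℝ × ℝ)}
    [IsProbabilityMeasure πs] (hπs : InDomain πs ρ (distFun f))
    (hπs₁ : TailAsymptotic (πs.map Prod.fst) (distFun f))
    (hπs₂ : TailAsymptotic (πs.map Prod.snd) (distFun f)) {n₀ : ℕ} {π : Measure (ℝ × ℝ)}
    [IsProbabilityMeasure π]
    (hπ : IsRestrictionNearInfinity π πs (diagonalRegion (distFun f) n₀)) :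
    HasSectorTails π (distFun f) fun e => ρ.real {w | 0 < e * w.1 ∧ 1 < w.2} where
  sum_eq_one := by
    -- The two quadrants exhaust the halfplane `w.2 > 1` up to the null vertical axis, and this
    -- halfplane has mass one.
    have h1 := hρ.measure_add
    rw [hρ.measure_snd_gt_one hlam] at h1
    have h2 : {w : ℝ × ℝ | 0 < 1 * w.1 ∧ 1 < w.2} = Ioi 0 ×ˢ Ioi 1 := by
      ext w
      simp
    have h3 : {w : ℝ × ℝ | 0 < -1 * w.1 ∧ 1 < w.2} = Iio 0 ×ˢ Ioi 1 := by
      ext w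
      simp
    have h4 : ρ (Iio 0 ×ˢ Ioi 1) ≠ ⊤ := ne_top_of_le_ne_top ENNReal.one_ne_top
      (h1 ▸ le_self_add)
    have h5 : ρ (Ioi 0 ×ˢ Ioi 1) ≠ ⊤ := ne_top_of_le_ne_top ENNReal.one_ne_top
      (h1 ▸ le_add_self)
    rw [h2, h3, measureReal_def, measureReal_def, ← ENNReal.toReal_add h5 h4, add_comm, ← h1,
      ENNReal.toReal_one]
  sector e he η hη := exists_le_measureReal_sector hf (hπs.dominatedTail hf hπs₂) hπs
    (hρ.measure_snd_gt_one hlam) hπ he hη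
  upper η hη := eventually_measureReal_snd_ge_le hf hπs₂ hπ hη
  lateral := eventually_measureReal_abs_fst_ge_le hf hπs₁ hπ

end

/-! ### The proposition -/

theorem mainTheorem11
    -- the marginal densities of the original and of the meta distribution
    (f₀ g₀ ψ : ℝ → ℝ) (hf₀ : IsSymmetricDensity f₀) (hg₀ : IsSymmetricDensity g₀)
    (hψ : IsVonMises ψ)
    (hgψ : Tendsto (fun s => g₀ s / Real.exp (-ψ s)) atTop (𝓝 1))
    -- the excess measure and a law in its domain
    (lam : ℝ) (hlam : 0 < lam) (ρ : Measure (ℝ × ℝ)) (hρ : IsExcessMeasure ρ lam)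
    (πs : Measure (ℝ × ℝ)) [IsProbabilityMeasure πs]
    (hπs : InDomain πs ρ (distFun f₀))
    (hπs₁ : TailAsymptotic (πs.map Prod.fst) (distFun f₀))
    (hπs₂ : TailAsymptotic (πs.map Prod.snd) (distFun f₀))
    -- the original law, which lives on the diagonal region, and its meta distribution
    (n₀ : ℕ) (π : Measure (ℝ × ℝ)) [IsProbabilityMeasure π]
    (hπ : IsRestrictionNearInfinity π πs (diagonalRegion (distFun f₀) n₀))
    (μ : Measure (ℝ × ℝ)) [IsProbabilityMeasure μ]
    (hμ : IsMetaDistribution μ π f₀ g₀)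
    -- the weights
    (cminus cplus c pminus pplus : ENNReal)
    (hcminus : cminus = ρ (Iio 0 ×ˢ Ioi 1)) (hcplus : cplus = ρ (Ioi 0 ×ˢ Ioi 1))
    (hc : c = ρ (univ ×ˢ Ioi 1))
    (hpminus : pminus = cminus / c) (hpplus : pplus = cplus / c) :
    (cminus = rhoPlus ρ ({0} ×ˢ Ioi 1) ∧
      cminus = sigmaPlus ρ lam ({⊥} ×ˢ Ioo 0 ⊤) ∧
      cplus = sigmaReal ρ lam (univ ×ˢ Ioi 0) ∧
      c = cminus + cplus ∧ pminus + pplus = 1) ∧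
    -- the high risk scenarios converge to independent `U`, `V`
    ((∀ t : ℝ, μ (upperHalfplane t) ≠ 0) ∧
      ∀ φ : (ℝ × ℝ) →ᵇ ℝ,
        Tendsto (fun t : ℝ => ∫ x, φ (normInv (scaleFun ψ) t x) ∂(μ[|upperHalfplane t])) atTop
          (𝓝 (∫ w, φ w ∂((twoPoint pminus pplus).prod (expMeasure 1))))) ∧
    -- the sample clouds converge to the Poisson point process on two vertical lines
    (∀ (r : ℕ → ℝ),
      Tendsto (fun n : ℕ => (n : ℝ) * μ.real (upperHalfplane (r n))) atTop (𝓝 1) →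
      ∀ {Ω : Type*} [MeasurableSpace Ω] (P : Measure Ω) [IsProbabilityMeasure P]
        (X : ℕ → Ω → ℝ × ℝ), (∀ i, HasLaw (X i) μ P) → iIndepFun X P →
      ∀ {Ω' : Type*} [MeasurableSpace Ω'] (P' : Measure Ω') [IsProbabilityMeasure P']
        (M : Ω' → Measure (ℝ × ℝ)),
        IsPoissonProcess M ((twoPoint pminus pplus).prod expIntensity) P' →
        ∀ v₀ : ℝ, ConvergesWeaklyOn (fun n => sampleCloud (scaleFun ψ) (r n) X n) P M P'
          {w | v₀ ≤ w.2}) := by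
  have hc1 : c = 1 := by rw [hc, hρ.measure_snd_gt_one hlam]
  have hsum : c = cminus + cplus := by rw [hc, hcminus, hcplus, hρ.measure_add]
  have hpm : pminus = cminus := by rw [hpminus, hc1, div_one]
  have hpp : pplus = cplus := by rw [hpplus, hc1, div_one]
  have hp1 : pminus + pplus = 1 := by rw [hpm, hpp, ← hsum, hc1]
  have hpm_top : pminus ≠ ⊤ := ne_top_of_le_ne_top ENNReal.one_ne_top (hp1 ▸ le_self_add)
  have hpp_top : pplus ≠ ⊤ := ne_top_of_le_ne_top ENNReal.one_ne_top (hp1 ▸ le_add_self)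
  have hprob : IsProbabilityMeasure (twoPoint pminus pplus) := isProbabilityMeasure_twoPoint hp1
  have hdom := hπs.dominatedTail hf₀ hπs₂
  have hsec := hasSectorTails hf₀ hlam hρ hπs hπs₁ hπs₂ hπ
  have hm1 : ρ.real {w | 0 < -1 * w.1 ∧ 1 < w.2} = pminus.toReal := by
    have : {w : ℝ × ℝ | 0 < -1 * w.1 ∧ 1 < w.2} = Iio 0 ×ˢ Ioi 1 := by
      ext w
      simp
    rw [this, hpm, hcminus, measureReal_def]
  have hm2 : ρ.real {w | 0 < 1 * w.1 ∧ 1 < w.2} = pplus.toReal := by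
    have : {w : ℝ × ℝ | 0 < 1 * w.1 ∧ 1 < w.2} = Ioi 0 ×ˢ Ioi 1 := by
      ext w
      simp
    rw [this, hpp, hcplus, measureReal_def]
  refine ⟨⟨?_, ?_, ?_, hsum, hp1⟩,
    ⟨hsec.measure_upperHalfplane_ne_zero hf₀ hg₀ hμ, fun φ => ?_⟩, ?_⟩
  · rw [hcminus, hρ.measure_Iio_eq_rhoPlus]
  · rw [hcminus, hρ.measure_Iio_eq_sigmaPlus hlam]
  · rw [hcplus, IsExcessMeasure.measure_Ioi_eq_sigmaReal ρ hlam]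
  -- The case `v₀ = 0`, in which the halfplane is `H_t` itself and the shifted law is the standard
  -- exponential.
  · simpa only [mul_zero, add_zero, shiftedExp_zero] using hsec.tendsto_highRiskScenario hdom hf₀
      hg₀ hψ hgψ hμ hpm_top hpp_top hm1 hm2 0 φ
  · intro r hr Ω _ P _ X hX hind Ω' _ P' _ M hM v₀
    refine convergesWeaklyOn_sampleCloud hX hind hM
      (measurableSet_le measurable_const measurable_snd) ?_ _ r fun χ =>
        hsec.tendsto_mul_setIntegral hdom hf₀ hg₀ hψ hgψ hμ hpm_top hpp_top hm1 hm2 hr v₀ χ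
    -- It remains to see that the limiting mean measure of `v ≥ v₀` is finite; it equals `e^{-v₀}`.
    have h0 : SFinite expIntensity := by
      unfold expIntensity
      infer_instance
    have h1 : {w : ℝ × ℝ | v₀ ≤ w.2} = univ ×ˢ Ici v₀ := by
      ext w
      simp
    rw [h1, Measure.prod_prod, measure_univ, one_mul, expIntensity_Ici]
    exact ENNReal.ofReal_ne_top
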